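/- Let $d\in\mathbb N$, and let $e_0,\dots,e_d$ be the canonical basis of $\mathbb N^{d+1}$. **Trees.** A decorated tree is a finite non-planar rooted tree with node decorations in $\mathbb N^{d+1}$ and two kinds of edges: edges $I_a$ with $a\in\mathbb N^{d+1}$, and noise edges $\Xi$, which are terminal and end in an undecorated leaf. Equivalently, decorated trees are the expressions $\tau=X^{\ell}\,\Xi^{m}\prod_{i=1}^r I_{a_i}(\tau_i)$ with $\ell\in\mathbb N^{d+1}$, $m,r\in\mathbb N$ and decorated trees $\tau_i$, where the product is commutative; here $\ell$ is the decoration of the root and $I_a(\tau)$ (a planted tree) is $\tau$ grafted onto a new undecorated root by an edge $I_a$. Let $N_\tau$ be the set of nodes of $\tau$ other than the leaves of noise edges, and let $\mathfrak n_v$ be the decoration of $v\in N_\tau$. Put $$\sigma\,\widehat\curvearrowright^{a}\tau=\sum_{v\in N_\tau}\ \sum_{\ell\in\mathbb N^{d+1},\ \ell\le a,\ \ell\le \mathfrak n_v}\binom{\mathfrak n_v}{\ell}\ \sigma\curvearrowright_v^{a-\ell}(\uparrow_v^{-\ell}\tau),\qquad \uparrow^i\tau=\sum_{v\in N_\tau}\uparrow_v^{e_i}\tau,$$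 where $\uparrow_v^{k}$ adds $k$ to the decoration of $v$, $\sigma\curvearrowright^{b}_v\tau$ attaches $\sigma$ to the node $v$ of $\tau$ by a new edge $I_{b}$, and $\binom{\mathfrak n_v}{\ell}$ is the product of the binomial coefficients of the components. **The post-Lie algebra.** Let $\mathcal V$ be the real vector space with basis all planted trees $I_a(\tau)$ and all $X_i$, $0\le i\le d$. Let $[\cdot,\cdot]_0$ be the Lie bracket on $\mathcal V$ with $[I_a(\tau),X_i]_0=I_{a-e_i}(\tau)$ (zero if $a_i=0$) which vanishes on pairs of planted trees and on pairs of monomials, and let $\widehat\triangleright$ be the bilinear product with $$X_i\,\widehat\triangleright\, I_a(\tau)=I_a(\uparrow^i\tau),\quad I_a(\sigma)\,\widehat\triangleright\, I_b(\tau)=I_b(\sigma\,\widehat\curvearrowright^{a}\tau),\quad I_a(\tau)\,\widehat\triangleright\, X_i=0,\quad X_i\,\widehat\triangleright\, X_j=0 .$$ Then $(\mathcal V,[\cdot,\cdot]_0,\widehat\triangleright)$ is a post-Lie algebra, and $[[x,y]]=[x,y]_0+x\,\widehat\triangleright\, y-y\,\widehat\triangleright\, x$ is a second Lie bracket on $\mathcal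 V$. Let $U(\mathcal V_0)$ and $U(\mathcal V)$ be the enveloping algebras of $(\mathcal V,[\cdot,\cdot]_0)$ and $(\mathcal V,[[\cdot,\cdot]])$, with their usual Hopf algebra structures, in which $\Delta x=x\otimes 1+1\otimes x$ for $x\in\mathcal V$. **Theorem.** The product $\widehat\triangleright$ extends uniquely to a bilinear product $\triangleright$ on $U(\mathcal V_0)$ such that, for $x,y,y_i\in\mathcal V$ and $A,B,C\in U(\mathcal V_0)$, $$x\triangleright 1=0,\quad x\triangleright y_1\cdots y_n=\sum_{i=1}^n y_1\cdots(x\,\widehat\triangleright\, y_i)\cdots y_n,\quad 1\triangleright A=A,$$ $$xA\triangleright y=x\triangleright(A\triangleright y)-(x\triangleright A)\triangleright y,\quad A\triangleright BC=\sum_{(A)}(A^{(1)}\triangleright B)(A^{(2)}\triangleright C).$$ With the product $A*B=\sum_{(A)}A^{(1)}(A^{(2)}\triangleright B)$, the unit $1$, and the coproduct $\Delta$ and counit of $U(\mathcal V_0)$, the space $U(\mathcal V_0)$ is a Hopf algebra $(U(\mathcal V_0),*,\Delta)$, and there is an isomorphism of Hopf algebras $e:U(\mathcal V)\to(U(\mathcal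 V_0),*,\Delta)$ which is the identity on $\mathcal V$. Moreover, the elements $$B_{(\mathbf F,\mathbf m)}=X_0^{m_0}\cdots X_d^{m_d}\; I_{a_1}(\sigma_1)\cdots I_{a_n}(\sigma_n)\in U(\mathcal V_0)$$ (with the products of the enveloping algebra $U(\mathcal V_0)$), where $\mathbf m\in\mathbb N^{d+1}$ and $\mathbf F$ ranges over all forests, that is finite multisets $\{I_{a_1}(\sigma_1),\dots,I_{a_n}(\sigma_n)\}$ of planted trees, do not depend on the order in which the planted trees are multiplied and form a basis of $U(\mathcal V_0)$. Their preimages under $e$ form a basis of $U(\mathcal V)$. -/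

import Mathlib

open scoped TensorProduct

/-! ### Decorated trees -/

/-- Elements of `ℕ^{d+1}`. -/
abbrev MultiIdx (d : ℕ) : Type := Fin (d + 1) → ℕ

/-- The canonical basis vector `e_i` of `ℕ^{d+1}`. -/
def MultiIdx.e {d : ℕ} (i : Fin (d + 1)) : MultiIdx d := Pi.single i 1

/-- Decorated trees in symbolic notation, with an ordering of the branches at every node:
`base n m` is `X^n Ξ^m` and `graft a σ τ` is the tree product `I_a(σ) · τ`.
Every `X^n Ξ^m I_{a_1}(τ_1) ⋯ I_{a_r}(τ_r)` arises in this way. Noise edges end in an undecorated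
leaf that never plays a role, so a node only records the number `m` of noise edges above it. -/
inductive PreTree (d : ℕ) : Type
  | base (n : MultiIdx d) (m : ℕ) : PreTree d
  | graft (a : MultiIdx d) (σ τ : PreTree d) : PreTree d

namespace PreTree

variable {d : ℕ}

/-- Equality of decorated trees up to reordering of the branches at every node. -/
inductive Rel : PreTree d → PreTree d → Prop
  | refl (τ : PreTree d) : Rel τ τ
  | symm {τ τ' : PreTree d} : Rel τ τ' → Rel τ' τ
  | trans {τ τ' τ'' : PreTree d} : Rel τ τ' → Rel τ' τ'' → Rel τ τ''
  | congr (a : MultiIdx d) {σ σ' τ τ' : PreTree d} :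
      Rel σ σ' → Rel τ τ' → Rel (graft a σ τ) (graft a σ' τ')
  | swap (a b : MultiIdx d) (σ ρ τ : PreTree d) :
      Rel (graft a σ (graft b ρ τ)) (graft b ρ (graft a σ τ))

instance setoid (d : ℕ) : Setoid (PreTree d) :=
  ⟨Rel, Rel.refl, Rel.symm, Rel.trans⟩

/-- The node set `N_τ` (without the leaves of the noise edges). The root of `I_a(σ) · τ` is the
root of `τ`. -/
def Node : PreTree d → Type
  | base _ _ => Unit
  | graft _ σ τ => Node σ ⊕ Node τ

/-- The node set is finite. -/
instance fintypeNode : (τ : PreTree d) → Fintype (Node τ)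
  | base _ _ => inferInstanceAs (Fintype Unit)
  | graft _ σ τ =>
      letI := fintypeNode σ
      letI := fintypeNode τ
      inferInstanceAs (Fintype (Node σ ⊕ Node τ))

/-- The node decoration `𝔫_v`. -/
def deco : (τ : PreTree d) → Node τ → MultiIdx d
  | base n _, _ => n
  | graft _ σ _, Sum.inl v => deco σ v
  | graft _ _ τ, Sum.inr v => deco τ v

/-- `↑_v^k τ`: the decoration of the node `v` is increased by `k`. -/
def upAt (k : MultiIdx d) : (τ : PreTree d) → Node τ → PreTree d
  | base n m, _ => base (n + k) m
  | graft a σ τ, Sum.inl v => graft a (upAt k σ v) τ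
  | graft a σ τ, Sum.inr v => graft a σ (upAt k τ v)

/-- `σ ↷_v^b (↑_v^{-ℓ} τ)`: the decoration of the node `v` of `τ` is decreased by `ℓ`, and `σ` is
attached to `v` by a new edge `I_b`. Only used with a coefficient that vanishes unless
`ℓ ≤ 𝔫_v`. -/
def graftAt (b : MultiIdx d) (σ : PreTree d) (ℓ : MultiIdx d) :
    (τ : PreTree d) → Node τ → PreTree d
  | base n m, _ => graft b σ (base (n - ℓ) m)
  | graft a ρ τ, Sum.inl v => graft a (graftAt b σ ℓ ρ v) τ
  | graft a ρ τ, Sum.inr v => graft a ρ (graftAt b σ ℓ τ v)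

end PreTree

/-- The set of (non-planar) decorated trees. -/
abbrev DTree (d : ℕ) : Type := Quotient (PreTree.setoid d)

/-- The linear span of the decorated trees. -/
abbrev TreeSpan (d : ℕ) : Type := DTree d →₀ ℝ

namespace PreTree

variable {d : ℕ}

/-- A tree as a basis vector of the span of the non-planar trees. -/
noncomputable def cls (τ : PreTree d) : TreeSpan d := Finsupp.single (Quotient.mk _ τ) 1

/-- The deformed grafting product
`∑_{v ∈ N_τ} ∑_ℓ (𝔫_v choose ℓ) σ ↷_v^{a-ℓ} (↑_v^{-ℓ} τ)`, where only `ℓ ≤ a` contribute. -/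
noncomputable def dgraft (a : MultiIdx d) (σ τ : PreTree d) : TreeSpan d :=
  ∑ v : Node τ, ∑ ℓ ∈ Finset.Iic a,
    (((∏ i, (deco τ v i).choose (ℓ i) : ℕ)) : ℝ) • cls (graftAt (a - ℓ) σ ℓ τ v)

/-- `↑^i τ = ∑_{v ∈ N_τ} ↑_v^{e_i} τ`. -/
noncomputable def up (i : Fin (d + 1)) (τ : PreTree d) : TreeSpan d :=
  ∑ v : Node τ, cls (upAt (MultiIdx.e i) τ v)

end PreTree

namespace TreeSpan

variable {d : ℕ}

/-- The bilinear extension of `(σ, τ) ↦ I_a(σ) · τ`. -/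
noncomputable def plant (a : MultiIdx d) : TreeSpan d →ₗ[ℝ] TreeSpan d →ₗ[ℝ] TreeSpan d :=
  Finsupp.linearCombination ℝ fun σ => Finsupp.linearCombination ℝ fun τ =>
    Finsupp.single (Quotient.map₂ (PreTree.graft a)
      (fun _ _ h _ _ h' => PreTree.Rel.congr a h h') σ τ) 1

open PreTree

theorem plant_cls (a : MultiIdx d) (σ τ : PreTree d) :
    plant a (cls σ) (cls τ) = cls (graft a σ τ) := by
  simp [plant, cls]

theorem induction {p : TreeSpan d → Prop} (x : TreeSpan d) (h0 : p 0)
    (hadd : ∀ x y, p x → p y → p (x + y)) (hs : ∀ (c : ℝ) τ, p (c • cls τ)) : p x := by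
  induction x using Finsupp.induction_linear with
  | zero => exact h0
  | add x y hx hy => exact hadd x y hx hy
  | single t c =>
    induction t using Quotient.inductionOn with
    | h τ => simpa [cls] using hs c τ

theorem hom_ext {M : Type*} [AddCommGroup M] [Module ℝ M] {f g : TreeSpan d →ₗ[ℝ] M}
    (h : ∀ τ, f (cls τ) = g (cls τ)) : f = g := by
  ext t
  induction t using Quotient.inductionOn with
  | h τ => simpa [cls] using h τ

theorem plant_comm (a b : MultiIdx d) (x y z : TreeSpan d) :
    plant a x (plant b y z) = plant b y (plant a x z) := by
  induction x using TreeSpan.induction with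
  | h0 => simp
  | hadd x x' hx hx' => simp [hx, hx']
  | hs c σ =>
  induction y using TreeSpan.induction with
  | h0 => simp
  | hadd x x' hx hx' => simp only [map_add, LinearMap.add_apply, hx, hx']
  | hs c' ρ =>
  induction z using TreeSpan.induction with
  | h0 => simp
  | hadd x x' hx hx' => simp only [map_add, hx, hx']
  | hs c'' τ =>
    simp only [map_smul, LinearMap.smul_apply, plant_cls]
    rw [show cls (graft a σ (graft b ρ τ)) = cls (graft b ρ (graft a σ τ)) by
      simp only [cls]; rw [Quotient.sound (Rel.swap a b σ ρ τ)]]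
    module

end TreeSpan

namespace PreTree

variable {d : ℕ}

open TreeSpan

theorem cls_eq {σ τ : PreTree d} (h : Rel σ τ) : cls σ = cls τ := by
  simp only [cls]; rw [Quotient.sound h]

theorem dgraft_base (a : MultiIdx d) (σ : PreTree d) (n : MultiIdx d) (m : ℕ) :
    dgraft a σ (base n m) = ∑ ℓ ∈ Finset.Iic a,
      (((∏ i, (n i).choose (ℓ i) : ℕ)) : ℝ) • cls (graft (a - ℓ) σ (base (n - ℓ) m)) :=
  Fintype.sum_unique (ι := Unit) _

theorem dgraft_graft (a : MultiIdx d) (σ : PreTree d) (b : MultiIdx d) (ρ τ : PreTree d) :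
    dgraft a σ (graft b ρ τ) =
      plant b (dgraft a σ ρ) (cls τ) + plant b (cls ρ) (dgraft a σ τ) := by
  refine (Fintype.sum_sum_type (α₁ := Node ρ) (α₂ := Node τ) _).trans ?_
  simp only [dgraft, map_sum, LinearMap.sum_apply, map_smul, LinearMap.smul_apply, plant_cls]
  rfl

theorem up_base (i : Fin (d + 1)) (n : MultiIdx d) (m : ℕ) :
    up i (base n m) = cls (base (n + MultiIdx.e i) m) :=
  Fintype.sum_unique (ι := Unit) _

theorem up_graft (i : Fin (d + 1)) (b : MultiIdx d) (ρ τ : PreTree d) :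
    up i (graft b ρ τ) = plant b (up i ρ) (cls τ) + plant b (cls ρ) (up i τ) := by
  refine (Fintype.sum_sum_type (α₁ := Node ρ) (α₂ := Node τ) _).trans ?_
  simp only [up, map_sum, LinearMap.sum_apply, plant_cls]
  rfl

theorem up_congr (i : Fin (d + 1)) {τ τ' : PreTree d} (h : Rel τ τ') : up i τ = up i τ' := by
  induction h with
  | refl => rfl
  | symm _ h => exact h.symm
  | trans _ _ h h' => exact h.trans h'
  | congr a h1 h2 ih1 ih2 => simp only [up_graft, ih1, ih2, cls_eq h1, cls_eq h2]
  | swap a b σ ρ τ =>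
    simp only [up_graft, map_add, ← plant_cls]
    rw [plant_comm a b, plant_comm a b, plant_comm a b]
    abel

theorem dgraft_congr_right (a : MultiIdx d) (σ : PreTree d) {τ τ' : PreTree d} (h : Rel τ τ') :
    dgraft a σ τ = dgraft a σ τ' := by
  induction h with
  | refl => rfl
  | symm _ h => exact h.symm
  | trans _ _ h h' => exact h.trans h'
  | congr a h1 h2 ih1 ih2 => simp only [dgraft_graft, ih1, ih2, cls_eq h1, cls_eq h2]
  | swap a b σ ρ τ =>
    simp only [dgraft_graft, map_add, ← plant_cls]
    rw [plant_comm a b, plant_comm a b, plant_comm a b]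
    abel

theorem dgraft_congr_left (a : MultiIdx d) {σ σ' : PreTree d} (h : Rel σ σ') (τ : PreTree d) :
    dgraft a σ τ = dgraft a σ' τ := by
  induction τ with
  | base n m => simp only [dgraft_base, ← plant_cls, cls_eq h]
  | graft b ρ τ ih1 ih2 => simp only [dgraft_graft, ih1, ih2]

end PreTree

namespace TreeSpan

variable {d : ℕ}

open PreTree

/-- The deformed grafting product `σ ↷̂^a τ` on the span of the decorated trees. -/
noncomputable def dgraft (a : MultiIdx d) : TreeSpan d →ₗ[ℝ] TreeSpan d →ₗ[ℝ] TreeSpan d :=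
  Finsupp.linearCombination ℝ fun σ => Finsupp.linearCombination ℝ fun τ =>
    Quotient.lift₂ (PreTree.dgraft a)
      (fun _ _ _ _ h h' => (dgraft_congr_left a h _).trans (dgraft_congr_right a _ h')) σ τ

/-- The operator `↑^i` on the span of the decorated trees. -/
noncomputable def up (i : Fin (d + 1)) : TreeSpan d →ₗ[ℝ] TreeSpan d :=
  Finsupp.linearCombination ℝ fun τ => Quotient.lift (PreTree.up i) (fun _ _ h => up_congr i h) τ

theorem dgraft_cls (a : MultiIdx d) (σ τ : PreTree d) :
    dgraft a (cls σ) (cls τ) = PreTree.dgraft a σ τ := by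
  simp [dgraft, cls]

theorem up_cls (i : Fin (d + 1)) (τ : PreTree d) : up i (cls τ) = PreTree.up i τ := by
  simp [up, cls]

theorem dgraft_base (a : MultiIdx d) (x : TreeSpan d) (n : MultiIdx d) (m : ℕ) :
    dgraft a x (cls (base n m)) = ∑ ℓ ∈ Finset.Iic a,
      (((∏ i, (n i).choose (ℓ i) : ℕ)) : ℝ) • plant (a - ℓ) x (cls (base (n - ℓ) m)) := by
  induction x using TreeSpan.induction with
  | h0 => simp
  | hadd x x' hx hx' => simp [hx, hx', Finset.sum_add_distrib]
  | hs c σ =>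
    simp only [map_smul, LinearMap.smul_apply, dgraft_cls, PreTree.dgraft_base, plant_cls,
      Finset.smul_sum]
    exact Finset.sum_congr rfl fun _ _ => smul_comm _ _ _

theorem dgraft_plant (a : MultiIdx d) (x : TreeSpan d) (b : MultiIdx d) (y z : TreeSpan d) :
    dgraft a x (plant b y z) = plant b (dgraft a x y) z + plant b y (dgraft a x z) := by
  induction x using TreeSpan.induction with
  | h0 => simp
  | hadd x x' hx hx' => simp only [map_add, LinearMap.add_apply, hx, hx']; abel
  | hs c σ =>
  induction y using TreeSpan.induction with
  | h0 => simp
  | hadd x x' hx hx' => simp only [map_add, LinearMap.add_apply, hx, hx']; abel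
  | hs c' ρ =>
  induction z using TreeSpan.induction with
  | h0 => simp
  | hadd x x' hx hx' => simp only [map_add, hx, hx']; abel
  | hs c'' τ =>
    simp only [map_smul, LinearMap.smul_apply, plant_cls, dgraft_cls, PreTree.dgraft_graft]
    module

theorem up_plant (i : Fin (d + 1)) (b : MultiIdx d) (y z : TreeSpan d) :
    up i (plant b y z) = plant b (up i y) z + plant b y (up i z) := by
  induction y using TreeSpan.induction with
  | h0 => simp
  | hadd x x' hx hx' => simp only [map_add, LinearMap.add_apply, hx, hx']; abel
  | hs c' ρ =>
  induction z using TreeSpan.induction with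
  | h0 => simp
  | hadd x x' hx hx' => simp only [map_add, hx, hx']; abel
  | hs c'' τ =>
    simp only [map_smul, LinearMap.smul_apply, plant_cls, up_cls, PreTree.up_graft]
    module

end TreeSpan

namespace TreeSpan

variable {d : ℕ}

open PreTree

theorem choose_mul_choose_comm (n k j : ℕ) :
    n.choose k * (n - k).choose j = n.choose j * (n - j).choose k := by
  have h := Nat.choose_mul (n := n) (k := k + j) (s := k) (by omega)
  have h' := Nat.choose_mul (n := n) (k := k + j) (s := j) (by omega)
  rw [Nat.add_sub_cancel_left] at h
  rw [Nat.add_sub_cancel] at h'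
  rw [← h, ← h', Nat.choose_symm_add]

/-- The deformed grafting products satisfy the multi-pre-Lie identity. -/
theorem dgraft_preLie (a b : MultiIdx d) (x y z : TreeSpan d) :
    dgraft a x (dgraft b y z) - dgraft b (dgraft a x y) z =
      dgraft b y (dgraft a x z) - dgraft a (dgraft b y x) z := by
  induction z using TreeSpan.induction with
  | h0 => simp
  | hadd z z' hz hz' =>
    simp only [map_add]
    linear_combination (norm := module) hz + hz'
  | hs c τ =>
  suffices h : dgraft a x (dgraft b y (cls τ)) - dgraft b (dgraft a x y) (cls τ) =
      dgraft b y (dgraft a x (cls τ)) - dgraft a (dgraft b y x) (cls τ) by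
    simp only [map_smul, ← smul_sub, h]
  induction τ with
  | base n m =>
    simp only [dgraft_base, map_sum, map_smul, dgraft_plant, smul_add, Finset.sum_add_distrib,
      add_sub_cancel_left, Finset.smul_sum, smul_smul]
    rw [Finset.sum_comm]
    refine Finset.sum_congr rfl fun j _ => Finset.sum_congr rfl fun k _ => ?_
    rw [plant_comm, tsub_right_comm, ← Nat.cast_mul, ← Nat.cast_mul, ← Finset.prod_mul_distrib,
      ← Finset.prod_mul_distrib]
    congr 3
    exact funext fun i => choose_mul_choose_comm _ _ _
  | graft c ρ τ ih1 ih2 =>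
    have h1 := congrArg (fun w => plant c w (cls τ)) ih1
    have h2 := congrArg (plant c (cls ρ)) ih2
    simp only [map_sub, LinearMap.sub_apply] at h1 h2
    simp only [← plant_cls, dgraft_plant, map_add]
    linear_combination (norm := module) h1 + h2

/-- The non-commutation of `↑^i` with the deformed grafting products, `a_i ≠ 0`. -/
theorem dgraft_up_sub (a : MultiIdx d) (i : Fin (d + 1)) (x z : TreeSpan d) :
    dgraft a x (up i z) - (up i (dgraft a x z) - dgraft a (up i x) z) =
      if a i = 0 then 0 else dgraft (a - MultiIdx.e i) x z := by
  induction z using TreeSpan.induction with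
  | h0 => simp
  | hadd z z' hz hz' =>
    simp only [map_add]
    split_ifs at hz hz' ⊢ <;> linear_combination (norm := module) hz + hz'
  | hs c τ =>
  suffices h : dgraft a x (up i (cls τ)) - (up i (dgraft a x (cls τ)) - dgraft a (up i x) (cls τ)) =
      if a i = 0 then 0 else dgraft (a - MultiIdx.e i) x (cls τ) by
    simp only [map_smul, ← smul_sub, h, smul_ite, smul_zero]
  induction τ with
  | base n m =>
    have hle : ∀ b c : MultiIdx d, b ≤ c ↔ ∀ j, b j ≤ c j := fun _ _ => Iff.rfl
    have key : ∀ ℓ : MultiIdx d,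
        ((∏ j, ((n + MultiIdx.e i) j).choose (ℓ j) : ℕ) : ℝ) •
            plant (a - ℓ) x (cls (base (n + MultiIdx.e i - ℓ) m)) -
          ((∏ j, (n j).choose (ℓ j) : ℕ) : ℝ) •
            plant (a - ℓ) x (cls (base (n - ℓ + MultiIdx.e i) m)) =
        if ℓ i = 0 then 0 else
          ((∏ j, (n j).choose ((ℓ - MultiIdx.e i) j) : ℕ) : ℝ) •
            plant (a - ℓ) x (cls (base (n + MultiIdx.e i - ℓ) m)) := by
      intro ℓ
      have h1 : ((∏ j, (n j).choose (ℓ j) : ℕ) : ℝ) •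
            plant (a - ℓ) x (cls (base (n - ℓ + MultiIdx.e i) m)) =
          ((∏ j, (n j).choose (ℓ j) : ℕ) : ℝ) •
            plant (a - ℓ) x (cls (base (n + MultiIdx.e i - ℓ) m)) := by
        by_cases h : ℓ ≤ n
        · rw [tsub_add_eq_add_tsub h]
        · rw [hle, not_forall] at h
          obtain ⟨j, hj⟩ := h
          rw [Finset.prod_eq_zero (Finset.mem_univ j) (Nat.choose_eq_zero_of_lt (not_le.1 hj))]
          simp
      have h2 : (∏ j, ((n + MultiIdx.e i) j).choose (ℓ j)) = (∏ j, (n j).choose (ℓ j)) +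
          if ℓ i = 0 then 0 else ∏ j, (n j).choose ((ℓ - MultiIdx.e i) j) := by
        rw [← Finset.mul_prod_erase _ _ (Finset.mem_univ i),
          ← Finset.mul_prod_erase _ _ (Finset.mem_univ i),
          ← Finset.mul_prod_erase _ (fun j => (n j).choose ((ℓ - MultiIdx.e i) j))
            (Finset.mem_univ i)]
        have e1 : ∏ j ∈ Finset.univ.erase i, ((n + MultiIdx.e i) j).choose (ℓ j) =
            ∏ j ∈ Finset.univ.erase i, (n j).choose (ℓ j) :=
          Finset.prod_congr rfl fun j hj => by
            simp [MultiIdx.e, Pi.single_eq_of_ne (Finset.ne_of_mem_erase hj)]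
        have e2 : ∏ j ∈ Finset.univ.erase i, (n j).choose ((ℓ - MultiIdx.e i) j) =
            ∏ j ∈ Finset.univ.erase i, (n j).choose (ℓ j) :=
          Finset.prod_congr rfl fun j hj => by
            simp [MultiIdx.e, Pi.single_eq_of_ne (Finset.ne_of_mem_erase hj)]
        rw [e1, e2]
        rcases h : ℓ i with _ | k
        · simp
        · simp [MultiIdx.e, h, Nat.choose_succ_succ]; ring
      rw [h1, h2]
      split_ifs <;> push_cast <;> module
    have lhs : dgraft a x (up i (cls (base n m))) -
        (up i (dgraft a x (cls (base n m))) - dgraft a (up i x) (cls (base n m))) =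
        ∑ ℓ ∈ Finset.Iic a, if ℓ i = 0 then 0 else
          ((∏ j, (n j).choose ((ℓ - MultiIdx.e i) j) : ℕ) : ℝ) •
            plant (a - ℓ) x (cls (base (n + MultiIdx.e i - ℓ) m)) := by
      rw [← Finset.sum_congr rfl fun ℓ _ => key ℓ, up_cls, PreTree.up_base]
      simp only [dgraft_base, map_sum, map_smul, up_plant, up_cls, PreTree.up_base, smul_add,
        Finset.sum_add_distrib, Finset.sum_sub_distrib, add_sub_cancel_left]
    rw [lhs]
    split_ifs with ha
    · refine Finset.sum_eq_zero fun ℓ hℓ => if_pos ?_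
      have := (hle _ _).1 (Finset.mem_Iic.1 hℓ) i
      omega
    · rw [dgraft_base, ← Finset.sum_filter_add_sum_filter_not _ (fun ℓ : MultiIdx d => ℓ i = 0),
        Finset.sum_eq_zero (fun ℓ hℓ => if_pos (Finset.mem_filter.1 hℓ).2), zero_add]
      have hei : ∀ ℓ : MultiIdx d, ℓ i ≠ 0 → MultiIdx.e i ≤ ℓ := fun ℓ h => by
        rw [hle]; intro j
        by_cases hj : j = i
        · subst hj; simp [MultiIdx.e]; omega
        · simp [MultiIdx.e, Pi.single_eq_of_ne hj]
      refine Finset.sum_nbij' (fun ℓ => ℓ - MultiIdx.e i) (fun ℓ => ℓ + MultiIdx.e i) ?_ ?_ ?_ ?_ ?_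
      · intro ℓ hℓ
        rw [Finset.mem_filter, Finset.mem_Iic] at hℓ
        exact Finset.mem_Iic.2 (tsub_le_tsub_right hℓ.1 _)
      · intro ℓ hℓ
        rw [Finset.mem_Iic] at hℓ
        rw [Finset.mem_filter, Finset.mem_Iic]
        exact ⟨(le_tsub_iff_right (hei a ha)).1 hℓ, by simp [MultiIdx.e]⟩
      · intro ℓ hℓ
        exact tsub_add_cancel_of_le (hei ℓ (Finset.mem_filter.1 hℓ).2)
      · intro ℓ hℓ
        exact add_tsub_cancel_right _ _
      · intro ℓ hℓ
        have h := (Finset.mem_filter.1 hℓ).2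
        rw [if_neg h]
        have e1 : a - MultiIdx.e i - (ℓ - MultiIdx.e i) = a - ℓ :=
          tsub_tsub_tsub_cancel_right (hei ℓ h)
        have e2 : n + MultiIdx.e i - ℓ = n - (ℓ - MultiIdx.e i) := by
          conv_lhs => rw [← tsub_add_cancel_of_le (hei ℓ h)]
          exact add_tsub_add_eq_tsub_right _ _ _
        rw [e1, e2]
  | graft c ρ τ ih1 ih2 =>
    have h1 := congrArg (fun w => plant c w (cls τ)) ih1
    have h2 := congrArg (plant c (cls ρ)) ih2
    simp only [map_sub, LinearMap.sub_apply] at h1 h2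
    simp only [← plant_cls, dgraft_plant, up_plant, map_add]
    split_ifs at h1 h2 ⊢ <;> try simp only [map_zero, LinearMap.zero_apply] at h1 h2
    all_goals linear_combination (norm := module) h1 + h2

end TreeSpan

/-! ### Post-Lie algebras -/

/-- A post-Lie algebra: a Lie algebra with a bilinear product `x ▷ y = tri x y` such that
`x ▷ [y,z] = [x ▷ y, z] + [y, x ▷ z]` and `[x,y] ▷ z = a(x,y,z) - a(y,x,z)`, where
`a(x,y,z) = x ▷ (y ▷ z) - (x ▷ y) ▷ z`. -/
class PostLieAlgebra (R L : Type*) [CommRing R] [LieRing L] [LieAlgebra R L] where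
  /-- The post-Lie product. -/
  tri : L →ₗ[R] L →ₗ[R] L
  tri_lie (x y z : L) : tri x ⁅y, z⁆ = ⁅tri x y, z⁆ + ⁅y, tri x z⁆
  lie_tri (x y z : L) : tri ⁅x, y⁆ z =
    (tri x (tri y z) - tri (tri x y) z) - (tri y (tri x z) - tri (tri y x) z)

/-- A copy of a post-Lie algebra, carrying the bracket
`[[x, y]] = [x, y] + x ▷ y - y ▷ x`. -/
def PostLieBar (R L : Type*) [CommRing R] [LieRing L] [LieAlgebra R L] [PostLieAlgebra R L] :
    Type _ := L

namespace PostLieBar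

variable (R L : Type*) [CommRing R] [LieRing L] [LieAlgebra R L] [PostLieAlgebra R L]

instance : AddCommGroup (PostLieBar R L) := inferInstanceAs (AddCommGroup L)

instance : Module R (PostLieBar R L) := inferInstanceAs (Module R L)

/-- The identity map. -/
def of : L ≃ₗ[R] PostLieBar R L := LinearEquiv.refl R L

instance : Bracket (PostLieBar R L) (PostLieBar R L) :=
  ⟨fun x y => of R L (⁅(of R L).symm x, (of R L).symm y⁆ +
    PostLieAlgebra.tri (R := R) ((of R L).symm x) ((of R L).symm y) -
    PostLieAlgebra.tri (R := R) ((of R L).symm y) ((of R L).symm x))⟩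

theorem of_lie (x y : L) : ⁅of R L x, of R L y⁆ = of R L (⁅x, y⁆ +
    PostLieAlgebra.tri (R := R) x y - PostLieAlgebra.tri (R := R) y x) := rfl

instance : LieRing (PostLieBar R L) where
  add_lie x y z := by
    obtain ⟨x, rfl⟩ := (of R L).surjective x
    obtain ⟨y, rfl⟩ := (of R L).surjective y
    obtain ⟨z, rfl⟩ := (of R L).surjective z
    simp only [of_lie, ← map_add]
    congr 1
    simp only [add_lie, map_add, LinearMap.add_apply]
    abel
  lie_add x y z := by
    obtain ⟨x, rfl⟩ := (of R L).surjective x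
    obtain ⟨y, rfl⟩ := (of R L).surjective y
    obtain ⟨z, rfl⟩ := (of R L).surjective z
    simp only [of_lie, ← map_add]
    congr 1
    simp only [lie_add, map_add, LinearMap.add_apply]
    abel
  lie_self x := by
    obtain ⟨x, rfl⟩ := (of R L).surjective x
    simp [of_lie]
  leibniz_lie x y z := by
    obtain ⟨x, rfl⟩ := (of R L).surjective x
    obtain ⟨y, rfl⟩ := (of R L).surjective y
    obtain ⟨z, rfl⟩ := (of R L).surjective z
    simp only [of_lie, ← map_add]
    congr 1
    simp only [lie_add, add_lie, lie_sub, sub_lie, map_add, map_sub, LinearMap.add_apply,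
      LinearMap.sub_apply, PostLieAlgebra.tri_lie, PostLieAlgebra.lie_tri, leibniz_lie x y z]
    rw [← lie_skew (PostLieAlgebra.tri (R := R) z x) y]
    abel

instance : LieAlgebra R (PostLieBar R L) where
  lie_smul c x y := by
    obtain ⟨x, rfl⟩ := (of R L).surjective x
    obtain ⟨y, rfl⟩ := (of R L).surjective y
    rw [← map_smul, of_lie, of_lie, ← map_smul]
    congr 1
    simp [smul_sub, smul_add]

end PostLieBar

/-! ### The Hopf algebra structure of an enveloping algebra -/

namespace UniversalEnvelopingAlgebra

attribute [local instance 100] LieRing.ofAssociativeRing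

variable (R L : Type*) [CommRing R] [LieRing L] [LieAlgebra R L]

local notation "𝒰" => UniversalEnvelopingAlgebra R L

theorem induction {p : 𝒰 → Prop} (a : 𝒰) (hR : ∀ r, p (algebraMap R 𝒰 r))
    (hι : ∀ x, p (ι R x)) (hadd : ∀ a b, p a → p b → p (a + b))
    (hmul : ∀ a b, p a → p b → p (a * b)) : p a := by
  let S : Subalgebra R 𝒰 :=
    { carrier := {a | p a}
      mul_mem' := fun {a b} ha hb => hmul a b ha hb
      add_mem' := fun {a b} ha hb => hadd a b ha hb
      algebraMap_mem' := hR }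
  let f : L →ₗ⁅R⁆ S :=
    { toFun := fun x => ⟨ι R x, hι x⟩
      map_add' := fun x y => Subtype.ext (map_add _ x y)
      map_smul' := fun c x => Subtype.ext (map_smul _ c x)
      map_lie' := fun {x y} => Subtype.ext (LieHom.map_lie _ x y) }
  have h : S.val.comp (lift R f) = AlgHom.id R 𝒰 := by
    ext x
    change ((lift R f (ι R x) : S) : 𝒰) = ι R x
    rw [lift_ι_apply]
    rfl
  have h' : ((lift R f a : S) : 𝒰) = a := DFunLike.congr_fun h a
  rw [← h']
  exact (lift R f a).2

/-- The coproduct: `Δ x = x ⊗ 1 + 1 ⊗ x` for `x ∈ L`, extended multiplicatively. -/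
noncomputable def comulHom : 𝒰 →ₐ[R] 𝒰 ⊗[R] 𝒰 :=
  lift R
    { toFun := fun x => ι R x ⊗ₜ[R] 1 + 1 ⊗ₜ[R] ι R x
      map_add' := fun x y => by
        simp only [map_add, TensorProduct.add_tmul, TensorProduct.tmul_add]; abel
      map_smul' := fun c x => by simp [TensorProduct.smul_tmul']
      map_lie' := fun {x y} => by
        simp only [LieHom.map_lie, LieRing.of_associative_ring_bracket, add_mul, mul_add,
          Algebra.TensorProduct.tmul_mul_tmul, one_mul, mul_one, TensorProduct.sub_tmul,
          TensorProduct.tmul_sub]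
        abel }

/-- The counit: `ε(x) = 0` for `x ∈ L`. -/
noncomputable def counitHom : 𝒰 →ₐ[R] R := lift R 0

/-- The antipode: the anti-automorphism with `x ↦ -x` for `x ∈ L`. -/
noncomputable def antipodeHom : 𝒰 →ₐ[R] 𝒰ᵐᵒᵖ :=
  lift R
    { toFun := fun x => MulOpposite.op (-ι R x)
      map_add' := fun x y => by rw [map_add, neg_add, MulOpposite.op_add]
      map_smul' := fun c x => by
        rw [map_smul, ← smul_neg, MulOpposite.op_smul, RingHom.id_apply]
      map_lie' := fun {x y} => by
        simp only [LieHom.map_lie, LieRing.of_associative_ring_bracket, ← MulOpposite.op_mul,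
          ← MulOpposite.op_sub, neg_mul_neg, neg_sub] }

theorem comulHom_ι (x : L) : comulHom R L (ι R x) = ι R x ⊗ₜ[R] 1 + 1 ⊗ₜ[R] ι R x :=
  lift_ι_apply R _ x

theorem counitHom_ι (x : L) : counitHom R L (ι R x) = 0 := lift_ι_apply R _ x

theorem antipodeHom_ι (x : L) : antipodeHom R L (ι R x) = MulOpposite.op (-ι R x) :=
  lift_ι_apply R _ x

variable {R L} in
theorem algHom_ext {A : Type*} [Ring A] [Algebra R A] {f g : 𝒰 →ₐ[R] A}
    (h : ∀ x, f (ι R x) = g (ι R x)) : f = g :=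
  hom_ext R (LieHom.ext h)

noncomputable instance : Bialgebra R 𝒰 :=
  Bialgebra.ofAlgHom (comulHom R L) (counitHom R L)
    (algHom_ext fun x => by
      change Algebra.TensorProduct.assoc R R R 𝒰 𝒰 𝒰
        (Algebra.TensorProduct.map (comulHom R L) (.id R 𝒰) (comulHom R L (ι R x))) =
        Algebra.TensorProduct.map (.id R 𝒰) (comulHom R L) (comulHom R L (ι R x))
      rw [comulHom_ι]
      simp only [map_add, Algebra.TensorProduct.map_tmul, comulHom_ι, AlgHom.id_apply, map_one,
        Algebra.TensorProduct.one_def, TensorProduct.add_tmul, TensorProduct.tmul_add,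
        Algebra.TensorProduct.assoc_tmul]
      abel)
    (algHom_ext fun x => by
      change Algebra.TensorProduct.map (counitHom R L) (.id R 𝒰) (comulHom R L (ι R x)) =
        (1 : R) ⊗ₜ[R] ι R x
      rw [comulHom_ι]
      simp only [map_add, Algebra.TensorProduct.map_tmul, counitHom_ι, AlgHom.id_apply, map_one,
        TensorProduct.zero_tmul, zero_add])
    (algHom_ext fun x => by
      change Algebra.TensorProduct.map (.id R 𝒰) (counitHom R L) (comulHom R L (ι R x)) =
        ι R x ⊗ₜ[R] (1 : R)
      rw [comulHom_ι]
      simp only [map_add, Algebra.TensorProduct.map_tmul, counitHom_ι, AlgHom.id_apply, map_one,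
        TensorProduct.tmul_zero, add_zero])

theorem comul_ι (x : L) :
    Coalgebra.comul (R := R) (ι R x) = ι R x ⊗ₜ[R] 1 + 1 ⊗ₜ[R] ι R x := comulHom_ι R L x

theorem counit_ι (x : L) : Coalgebra.counit (R := R) (ι R x) = 0 := counitHom_ι R L x

/-- The antipode as a linear map. -/
noncomputable def antipodeLin : 𝒰 →ₗ[R] 𝒰 :=
  (MulOpposite.opLinearEquiv R).symm.toLinearMap ∘ₗ (antipodeHom R L).toLinearMap

theorem antipodeLin_ι (x : L) : antipodeLin R L (ι R x) = -ι R x :=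
  congrArg MulOpposite.unop (antipodeHom_ι R L x)

theorem antipodeLin_mul (a b : 𝒰) :
    antipodeLin R L (a * b) = antipodeLin R L b * antipodeLin R L a :=
  congrArg MulOpposite.unop (map_mul (antipodeHom R L) a b)

theorem antipodeLin_algebraMap (r : R) :
    antipodeLin R L (algebraMap R 𝒰 r) = algebraMap R 𝒰 r :=
  congrArg MulOpposite.unop ((antipodeHom R L).commutes r)

theorem mul_antipode_aux_left (a : 𝒰) : LinearMap.mul' R 𝒰
    ((antipodeLin R L).rTensor 𝒰 (Coalgebra.comul (R := R) a)) =
      algebraMap R 𝒰 (Coalgebra.counit (R := R) a) := by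
  have H : ∀ (t : 𝒰 ⊗[R] 𝒰) (p q : 𝒰),
      LinearMap.mul' R 𝒰 ((antipodeLin R L).rTensor 𝒰 (t * p ⊗ₜ q)) =
        antipodeLin R L p * LinearMap.mul' R 𝒰 ((antipodeLin R L).rTensor 𝒰 t) * q := by
    intro t p q
    induction t with
    | zero => simp
    | add t u ht hu => simp only [add_mul, mul_add, map_add, ht, hu]
    | tmul a b =>
      simp only [Algebra.TensorProduct.tmul_mul_tmul, LinearMap.rTensor_tmul,
        LinearMap.mul'_apply, antipodeLin_mul, mul_assoc]
  induction a using UniversalEnvelopingAlgebra.induction with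
  | hR r => simp [Algebra.TensorProduct.algebraMap_apply, antipodeLin_algebraMap]
  | hι x =>
    have h1 : antipodeLin R L 1 = 1 := by simpa using antipodeLin_algebraMap R L 1
    simp only [comul_ι, counit_ι, map_add, LinearMap.rTensor_tmul, LinearMap.mul'_apply,
      antipodeLin_ι, h1, mul_one, one_mul, neg_add_cancel, map_zero]
  | hadd a b ha hb => simp only [map_add, ha, hb]
  | hmul a b ha hb =>
    rw [Bialgebra.comul_mul, Bialgebra.counit_mul, map_mul (algebraMap R 𝒰), ← hb]
    generalize Coalgebra.comul (R := R) b = u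
    induction u with
    | zero => simp
    | add t u ht hu => simp only [mul_add, map_add, ht, hu]
    | tmul p q =>
      rw [H, ha, LinearMap.rTensor_tmul, LinearMap.mul'_apply, ← Algebra.commutes, mul_assoc]

theorem mul_antipode_aux_right (a : 𝒰) : LinearMap.mul' R 𝒰
    ((antipodeLin R L).lTensor 𝒰 (Coalgebra.comul (R := R) a)) =
      algebraMap R 𝒰 (Coalgebra.counit (R := R) a) := by
  have H : ∀ (t : 𝒰 ⊗[R] 𝒰) (p q : 𝒰),
      LinearMap.mul' R 𝒰 ((antipodeLin R L).lTensor 𝒰 (p ⊗ₜ q * t)) =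
        p * LinearMap.mul' R 𝒰 ((antipodeLin R L).lTensor 𝒰 t) * antipodeLin R L q := by
    intro t p q
    induction t with
    | zero => simp
    | add t u ht hu => simp only [add_mul, mul_add, map_add, ht, hu]
    | tmul a b =>
      simp only [Algebra.TensorProduct.tmul_mul_tmul, LinearMap.lTensor_tmul,
        LinearMap.mul'_apply, antipodeLin_mul, mul_assoc]
  induction a using UniversalEnvelopingAlgebra.induction with
  | hR r =>
    have h1 : antipodeLin R L 1 = 1 := by simpa using antipodeLin_algebraMap R L 1
    simp [Algebra.TensorProduct.algebraMap_apply, h1]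
  | hι x =>
    have h1 : antipodeLin R L 1 = 1 := by simpa using antipodeLin_algebraMap R L 1
    simp only [comul_ι, counit_ι, map_add, LinearMap.lTensor_tmul, LinearMap.mul'_apply,
      antipodeLin_ι, h1, mul_one, one_mul, add_neg_cancel, map_zero]
  | hadd a b ha hb => simp only [map_add, ha, hb]
  | hmul a b ha hb =>
    rw [Bialgebra.comul_mul, Bialgebra.counit_mul, map_mul (algebraMap R 𝒰), ← ha]
    generalize Coalgebra.comul (R := R) a = u
    induction u with
    | zero => simp
    | add t u ht hu => simp only [add_mul, map_add, ht, hu]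
    | tmul p q =>
      rw [H, hb, LinearMap.lTensor_tmul, LinearMap.mul'_apply, mul_assoc, Algebra.commutes,
        mul_assoc]

noncomputable instance : HopfAlgebra R 𝒰 where
  antipode := antipodeLin R L
  mul_antipode_rTensor_comul := LinearMap.ext (mul_antipode_aux_left R L)
  mul_antipode_lTensor_comul := LinearMap.ext (mul_antipode_aux_right R L)

end UniversalEnvelopingAlgebra

/-! ### The post-Lie algebra of planted trees and monomials -/

/-- A planted tree `I_a(τ)` is given by the decoration `a` of its trunk and by `τ`. -/
abbrev Planted (d : ℕ) : Type := MultiIdx d × DTree d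

/-- The real vector space with basis the planted trees `I_a(τ)` and the monomials `X_i`. -/
abbrev TreeLie (d : ℕ) : Type := (Planted d ⊕ Fin (d + 1)) →₀ ℝ

namespace TreeLie

variable {d : ℕ}

/-- The basis vector `I_a(τ)`, for `p = (a, τ)`. -/
noncomputable def planted (p : Planted d) : TreeLie d := Finsupp.single (Sum.inl p) 1

/-- The basis vector `X_i`. -/
noncomputable def X (i : Fin (d + 1)) : TreeLie d := Finsupp.single (Sum.inr i) 1

/-- The linear extension of `τ ↦ I_a(τ)`. -/
noncomputable def I (a : MultiIdx d) : TreeSpan d →ₗ[ℝ] TreeLie d :=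
  Finsupp.linearCombination ℝ fun τ => planted (a, τ)

/-- The linear extension of `τ ↦ I_{a - e_i}(τ)`, which vanishes if `a_i = 0`. -/
noncomputable def lower (i : Fin (d + 1)) (a : MultiIdx d) : TreeSpan d →ₗ[ℝ] TreeLie d :=
  if a i = 0 then 0 else I (a - MultiIdx.e i)

/-- The bracket `[·,·]_0`: `[I_a(τ), X_i]_0 = I_{a - e_i}(τ) = -[X_i, I_a(τ)]_0`, and all other
brackets of basis vectors vanish. -/
noncomputable def bracket₀ : TreeLie d →ₗ[ℝ] TreeLie d →ₗ[ℝ] TreeLie d :=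
  Finsupp.linearCombination ℝ fun p => Finsupp.linearCombination ℝ fun q =>
    match p, q with
    | Sum.inl (a, τ), Sum.inr i => lower i a (Finsupp.single τ 1)
    | Sum.inr i, Sum.inl (a, τ) => -lower i a (Finsupp.single τ 1)
    | Sum.inl _, Sum.inl _ => 0
    | Sum.inr _, Sum.inr _ => 0

/-- The product `▷̂`: `X_i ▷̂ I_a(τ) = I_a(↑^i τ)`, `I_a(σ) ▷̂ I_b(τ) = I_b(σ ↷̂^a τ)`,
`I_a(τ) ▷̂ X_i = 0` and `X_i ▷̂ X_j = 0`. -/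
noncomputable def triangle : TreeLie d →ₗ[ℝ] TreeLie d →ₗ[ℝ] TreeLie d :=
  Finsupp.linearCombination ℝ fun p => Finsupp.linearCombination ℝ fun q =>
    match p, q with
    | Sum.inl (a, σ), Sum.inl (b, τ) =>
        I b (TreeSpan.dgraft a (Finsupp.single σ 1) (Finsupp.single τ 1))
    | Sum.inr i, Sum.inl (b, τ) => I b (TreeSpan.up i (Finsupp.single τ 1))
    | Sum.inl _, Sum.inr _ => 0
    | Sum.inr _, Sum.inr _ => 0

theorem induction {p : TreeLie d → Prop} (v : TreeLie d) (h0 : p 0)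
    (hadd : ∀ x y, p x → p y → p (x + y)) (hI : ∀ a x, p (I a x))
    (hX : ∀ (c : ℝ) i, p (c • X i)) : p v := by
  induction v using Finsupp.induction_linear with
  | zero => exact h0
  | add x y hx hy => exact hadd x y hx hy
  | single t c =>
    rcases t with ⟨a, τ⟩ | i
    · simpa [I, planted] using hI a (Finsupp.single τ c)
    · simpa [X] using hX c i

theorem I_single (a : MultiIdx d) (τ : DTree d) (c : ℝ) :
    I a (Finsupp.single τ c) = Finsupp.single (Sum.inl (a, τ)) c := by
  simp [I, planted]

theorem bracket₀_I_I (a b : MultiIdx d) (x y : TreeSpan d) :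
    bracket₀ (I a x) (I b y) = 0 := by
  induction x using Finsupp.induction_linear with
  | zero => simp
  | add x x' hx hx' => simp only [map_add, LinearMap.add_apply, hx, hx', add_zero]
  | single σ c =>
  induction y using Finsupp.induction_linear with
  | zero => simp
  | add x x' hx hx' => simp only [map_add, hx, hx', add_zero]
  | single τ c' => simp [I_single, bracket₀]

theorem bracket₀_I_X (a : MultiIdx d) (x : TreeSpan d) (i : Fin (d + 1)) :
    bracket₀ (I a x) (X i) = lower i a x := by
  induction x using Finsupp.induction_linear with
  | zero => simp
  | add x x' hx hx' => simp only [map_add, LinearMap.add_apply, hx, hx']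
  | single σ c => simp [I_single, bracket₀, X, ← map_smul]

theorem bracket₀_X_I (a : MultiIdx d) (x : TreeSpan d) (i : Fin (d + 1)) :
    bracket₀ (X i) (I a x) = -lower i a x := by
  induction x using Finsupp.induction_linear with
  | zero => simp
  | add x x' hx hx' => simp only [map_add, hx, hx', neg_add]
  | single σ c => simp [I_single, bracket₀, X, ← map_smul]

theorem bracket₀_X_X (i j : Fin (d + 1)) : bracket₀ (X i) (X j) = 0 := by
  simp [bracket₀, X]

theorem triangle_I_I (a b : MultiIdx d) (x y : TreeSpan d) :
    triangle (I a x) (I b y) = I b (TreeSpan.dgraft a x y) := by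
  induction x using Finsupp.induction_linear with
  | zero => simp
  | add x x' hx hx' => simp only [map_add, LinearMap.add_apply, hx, hx']
  | single σ c =>
  induction y using Finsupp.induction_linear with
  | zero => simp
  | add x x' hx hx' => simp only [map_add, hx, hx']
  | single τ c' =>
    rw [← mul_one c, ← mul_one c', ← smul_eq_mul, ← smul_eq_mul, ← Finsupp.smul_single,
      ← Finsupp.smul_single]
    simp only [map_smul, LinearMap.smul_apply, I_single]
    simp [triangle]

theorem triangle_X_I (a : MultiIdx d) (x : TreeSpan d) (i : Fin (d + 1)) :
    triangle (X i) (I a x) = I a (TreeSpan.up i x) := by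
  induction x using Finsupp.induction_linear with
  | zero => simp
  | add x x' hx hx' => simp only [map_add, hx, hx']
  | single σ c => simp [I_single, triangle, X, ← map_smul]

theorem triangle_X (v : TreeLie d) (i : Fin (d + 1)) : triangle v (X i) = 0 := by
  induction v using Finsupp.induction_linear with
  | zero => simp
  | add x x' hx hx' => simp only [map_add, LinearMap.add_apply, hx, hx', add_zero]
  | single p c => rcases p with p | j <;> simp [triangle, X]

theorem bracket₀_skew (u v : TreeLie d) : -bracket₀ v u = bracket₀ u v := by
  induction u using TreeLie.induction with
  | h0 => simp
  | hadd x y hx hy => simp only [map_add, LinearMap.add_apply, ← hx, ← hy, neg_add]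
  | hI a x =>
    induction v using TreeLie.induction with
    | h0 => simp
    | hadd x y hx hy => simp only [map_add, LinearMap.add_apply, ← hx, ← hy, neg_add]
    | hI b y => simp only [bracket₀_I_I, neg_zero]
    | hX c i => simp only [map_smul, LinearMap.smul_apply, bracket₀_I_X, bracket₀_X_I, smul_neg,
        neg_neg]
  | hX c i =>
    induction v using TreeLie.induction with
    | h0 => simp
    | hadd x y hx hy => simp only [map_add, LinearMap.add_apply, ← hx, ← hy, neg_add]
    | hI b y => simp only [map_smul, LinearMap.smul_apply, bracket₀_I_X, bracket₀_X_I, smul_neg]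
    | hX c i => simp only [map_smul, LinearMap.smul_apply, bracket₀_X_X, smul_zero, neg_zero]

theorem bracket₀_lower (a : MultiIdx d) (x : TreeSpan d) (i j : Fin (d + 1)) :
    bracket₀ (lower i a x) (X j) = bracket₀ (lower j a x) (X i) := by
  by_cases hij : i = j
  · rw [hij]
  have h1 : (a - MultiIdx.e i) j = a j := by
    simp [MultiIdx.e, Pi.single_eq_of_ne (Ne.symm hij)]
  have h2 : (a - MultiIdx.e j) i = a i := by
    simp [MultiIdx.e, Pi.single_eq_of_ne hij]
  have h3 : a - MultiIdx.e i - MultiIdx.e j = a - MultiIdx.e j - MultiIdx.e i := tsub_right_comm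
  by_cases hi : a i = 0 <;> by_cases hj : a j = 0 <;>
    simp [lower, hi, hj, bracket₀_I_X, h1, h2, h3]

theorem bracket₀_lower_I (a b : MultiIdx d) (x y : TreeSpan d) (i : Fin (d + 1)) :
    bracket₀ (lower i a x) (I b y) = 0 := by
  rw [lower]; split_ifs <;> simp [bracket₀_I_I]

theorem bracket₀_I_lower (a b : MultiIdx d) (x y : TreeSpan d) (i : Fin (d + 1)) :
    bracket₀ (I b y) (lower i a x) = 0 := by
  rw [lower]; split_ifs <;> simp [bracket₀_I_I]

theorem bracket₀_X_lower (a : MultiIdx d) (x : TreeSpan d) (i j : Fin (d + 1)) :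
    bracket₀ (X i) (lower j a x) = -bracket₀ (lower i a x) (X j) := by
  rw [← bracket₀_skew, bracket₀_lower]

theorem bracket₀_leibniz (u v w : TreeLie d) : bracket₀ u (bracket₀ v w) =
    bracket₀ (bracket₀ u v) w + bracket₀ v (bracket₀ u w) := by
  induction u using TreeLie.induction with
  | h0 => simp
  | hadd x y hx hy => simp only [map_add, LinearMap.add_apply, hx, hy]; abel
  | hI a x =>
    induction v using TreeLie.induction with
    | h0 => simp
    | hadd x y hx hy => simp only [map_add, LinearMap.add_apply, hx, hy]; abel
    | hI b y =>
      induction w using TreeLie.induction with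
      | h0 => simp
      | hadd x y hx hy => simp only [map_add, hx, hy]; abel
      | hI c z => simp [bracket₀_I_I]
      | hX c k => simp [bracket₀_I_I, bracket₀_I_X, bracket₀_I_lower]
    | hX c j =>
      induction w using TreeLie.induction with
      | h0 => simp
      | hadd x y hx hy => simp only [map_add, hx, hy]; abel
      | hI c z => simp [bracket₀_I_I, bracket₀_I_X, bracket₀_X_I, bracket₀_I_lower,
          bracket₀_lower_I]
      | hX c k =>
        simp [bracket₀_I_X, bracket₀_X_X, bracket₀_X_lower, bracket₀_lower a x j k]
  | hX c i =>
    induction v using TreeLie.induction with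
    | h0 => simp
    | hadd x y hx hy => simp only [map_add, LinearMap.add_apply, hx, hy]; abel
    | hI b y =>
      induction w using TreeLie.induction with
      | h0 => simp
      | hadd x y hx hy => simp only [map_add, hx, hy]; abel
      | hI c z => simp [bracket₀_I_I, bracket₀_X_I, bracket₀_I_lower, bracket₀_lower_I]
      | hX c k => simp [bracket₀_I_X, bracket₀_X_I, bracket₀_X_X, bracket₀_X_lower]
    | hX c j =>
      induction w using TreeLie.induction with
      | h0 => simp
      | hadd x y hx hy => simp only [map_add, hx, hy]; abel
      | hI a z =>
        simp only [map_smul, LinearMap.smul_apply, map_neg, bracket₀_X_X, bracket₀_X_I,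
          bracket₀_X_lower, bracket₀_lower a z i j, smul_zero, map_zero, LinearMap.zero_apply]
        module
      | hX c k => simp [bracket₀_X_X]

noncomputable instance : LieRing (TreeLie d) where
  bracket u v := bracket₀ u v
  add_lie u v w := by simp only [map_add, LinearMap.add_apply]
  lie_add u v w := map_add _ _ _
  lie_self u := by
    have h := bracket₀_skew u u
    exact self_eq_neg.1 h.symm
  leibniz_lie := bracket₀_leibniz

noncomputable instance : LieAlgebra ℝ (TreeLie d) where
  lie_smul _ _ _ := map_smul _ _ _

theorem triangle_lie (u v w : TreeLie d) : triangle u (bracket₀ v w) =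
    bracket₀ (triangle u v) w + bracket₀ v (triangle u w) := by
  have key : ∀ (a b : MultiIdx d) (x y : TreeSpan d) i,
      triangle (I a x) (lower i b y) = lower i b (TreeSpan.dgraft a x y) := by
    intro a b x y i
    rw [lower]; split_ifs <;> simp [triangle_I_I]
  have key' : ∀ (b : MultiIdx d) (y : TreeSpan d) i j,
      triangle (X j) (lower i b y) = lower i b (TreeSpan.up j y) := by
    intro b y i j
    rw [lower]; split_ifs <;> simp [triangle_X_I]
  induction u using TreeLie.induction with
  | h0 => simp
  | hadd x y hx hy => simp only [map_add, LinearMap.add_apply, hx, hy]; abel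
  | hI a x =>
    induction v using TreeLie.induction with
    | h0 => simp
    | hadd x y hx hy => simp only [map_add, LinearMap.add_apply, hx, hy]; abel
    | hI b y =>
      induction w using TreeLie.induction with
      | h0 => simp
      | hadd x y hx hy => simp only [map_add, hx, hy]; abel
      | hI c z => simp [bracket₀_I_I, triangle_I_I]
      | hX c k => simp [bracket₀_I_X, triangle_I_I, triangle_X, key]
    | hX c j =>
      induction w using TreeLie.induction with
      | h0 => simp
      | hadd x y hx hy => simp only [map_add, hx, hy]; abel
      | hI c z => simp [bracket₀_X_I, triangle_I_I, triangle_X, key]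
      | hX c k => simp [bracket₀_X_X, triangle_X]
  | hX c i =>
    induction v using TreeLie.induction with
    | h0 => simp
    | hadd x y hx hy => simp only [map_add, LinearMap.add_apply, hx, hy]; abel
    | hI b y =>
      induction w using TreeLie.induction with
      | h0 => simp
      | hadd x y hx hy => simp only [map_add, hx, hy]; abel
      | hI c z => simp [bracket₀_I_I, triangle_X_I]
      | hX r k =>
        simp only [map_smul, LinearMap.smul_apply, bracket₀_I_X, triangle_X_I, triangle_X, key',
          smul_zero, map_zero]
        module
    | hX c j =>
      induction w using TreeLie.induction with
      | h0 => simp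
      | hadd x y hx hy => simp only [map_add, hx, hy]; abel
      | hI c z => simp [bracket₀_X_I, triangle_X_I, triangle_X, key']
      | hX c k => simp [bracket₀_X_X, triangle_X]

theorem lie_triangle (u v w : TreeLie d) : triangle (bracket₀ u v) w =
    (triangle u (triangle v w) - triangle (triangle u v) w) -
      (triangle v (triangle u w) - triangle (triangle v u) w) := by
  have key : ∀ (a b : MultiIdx d) (x y : TreeSpan d) i, triangle (lower i a x) (I b y) =
      I b (TreeSpan.dgraft a x (TreeSpan.up i y) -
        (TreeSpan.up i (TreeSpan.dgraft a x y) - TreeSpan.dgraft a (TreeSpan.up i x) y)) := by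
    intro a b x y i
    rw [TreeSpan.dgraft_up_sub, lower]
    split_ifs <;> simp [triangle_I_I]
  induction w using TreeLie.induction with
  | h0 => simp
  | hadd x y hx hy => simp only [map_add, hx, hy]; abel
  | hX c k => simp [triangle_X]
  | hI c z =>
    induction u using TreeLie.induction with
    | h0 => simp
    | hadd x y hx hy => simp only [map_add, LinearMap.add_apply, hx, hy]; abel
    | hI a x =>
      induction v using TreeLie.induction with
      | h0 => simp
      | hadd x y hx hy => simp only [map_add, LinearMap.add_apply, hx, hy]; abel
      | hI b y =>
        simp only [bracket₀_I_I, triangle_I_I, map_zero, LinearMap.zero_apply, ← map_sub,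
          TreeSpan.dgraft_preLie, sub_self]
      | hX r j =>
        simp only [map_smul, LinearMap.smul_apply, bracket₀_I_X, key, triangle_I_I, triangle_X_I,
          triangle_X, map_zero, LinearMap.zero_apply, map_sub, smul_zero, sub_zero, smul_sub]
    | hX r i =>
      induction v using TreeLie.induction with
      | h0 => simp
      | hadd x y hx hy => simp only [map_add, LinearMap.add_apply, hx, hy]; abel
      | hI b y =>
        simp only [map_smul, LinearMap.smul_apply, map_neg, LinearMap.neg_apply, bracket₀_X_I, key,
          triangle_I_I, triangle_X_I, triangle_X, map_zero, LinearMap.zero_apply, map_sub,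
          smul_zero, sub_zero]
        module
      | hX r' j =>
        have h : ∀ t : PreTree d, TreeSpan.up i (TreeSpan.up j t.cls) =
            TreeSpan.up j (TreeSpan.up i t.cls) := by
          intro t
          induction t with
          | base n m => simp only [TreeSpan.up_cls, PreTree.up_base, add_right_comm]
          | graft a σ τ h1 h2 =>
            simp only [← TreeSpan.plant_cls, TreeSpan.up_plant, map_add, h1, h2]; abel
        have h' : TreeSpan.up i (TreeSpan.up j z) = TreeSpan.up j (TreeSpan.up i z) :=
          LinearMap.congr_fun (f := TreeSpan.up i ∘ₗ TreeSpan.up j)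
            (g := TreeSpan.up j ∘ₗ TreeSpan.up i) (TreeSpan.hom_ext h) z
        simp only [map_smul, LinearMap.smul_apply, bracket₀_X_X, triangle_X_I, triangle_X, h',
          map_zero, LinearMap.zero_apply, smul_zero, sub_zero]
        module

noncomputable instance : PostLieAlgebra ℝ (TreeLie d) where
  tri := triangle
  tri_lie := triangle_lie
  lie_tri := lie_triangle

end TreeLie

/-! ### The product `*` on the enveloping algebra of a post-Lie algebra -/

namespace PostLieAlgebra

open UniversalEnvelopingAlgebra (ι)

variable {R L : Type*} [CommRing R] [LieRing L] [LieAlgebra R L]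

local notation "𝒰" => UniversalEnvelopingAlgebra R L

/-- `∑_{(A)} (A⁽¹⁾ ▷ B) (A⁽²⁾ ▷ C)`, where `A ▷ B = T A B`. -/
noncomputable def sweedlerTri (T : 𝒰 →ₗ[R] 𝒰 →ₗ[R] 𝒰) (A B C : 𝒰) : 𝒰 :=
  LinearMap.mul' R 𝒰 (TensorProduct.map (T.flip B) (T.flip C) (Coalgebra.comul (R := R) A))

/-- `A ▷ B = T A B` is an extension of the post-Lie product to the enveloping algebra:
* `x ▷ 1 = 0` and `x ▷ y₁ ⋯ yₙ = ∑ᵢ y₁ ⋯ (x ▷ yᵢ) ⋯ yₙ`;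
* `1 ▷ A = A` and `xA ▷ y = x ▷ (A ▷ y) - (x ▷ A) ▷ y`;
* `A ▷ BC = ∑_{(A)} (A⁽¹⁾ ▷ B) (A⁽²⁾ ▷ C)`,

for `x`, `y`, `yᵢ` in the Lie algebra and `A`, `B`, `C` in its enveloping algebra. -/
structure IsExtension [PostLieAlgebra R L] (T : 𝒰 →ₗ[R] 𝒰 →ₗ[R] 𝒰) : Prop where
  ι_one (x : L) : T (ι R x) 1 = 0
  ι_prod (x : L) (y : List L) : T (ι R x) (y.map (ι R)).prod =
    ∑ i : Fin y.length, ((y.set i (tri (R := R) x y[i])).map (ι R)).prod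
  one (A : 𝒰) : T 1 A = A
  ι_mul (x : L) (A : 𝒰) (y : L) :
    T (ι R x * A) (ι R y) = T (ι R x) (T A (ι R y)) - T (T (ι R x) A) (ι R y)
  mul (A B C : 𝒰) : T A (B * C) = sweedlerTri T A B C

/-- `A * B = ∑_{(A)} A⁽¹⁾ (A⁽²⁾ ▷ B)`, where `A ▷ B = T A B`. -/
noncomputable def star (T : 𝒰 →ₗ[R] 𝒰 →ₗ[R] 𝒰) : 𝒰 →ₗ[R] 𝒰 →ₗ[R] 𝒰 :=
  LinearMap.mk₂ R
    (fun A B => LinearMap.mul' R 𝒰 ((T.flip B).lTensor 𝒰 (Coalgebra.comul (R := R) A)))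
    (fun A A' B => by simp only [map_add])
    (fun c A B => by simp only [map_smul])
    (fun A B B' => by simp only [map_add, LinearMap.lTensor_add, LinearMap.add_apply])
    (fun c A B => by simp only [map_smul, LinearMap.lTensor_smul, LinearMap.smul_apply])

end PostLieAlgebra

/-- The `R`-module `H` with the product `mul`, the unit `one`, the coproduct `comul`, the counit
`counit` and the antipode `antipode` is a Hopf algebra. -/
structure IsHopfAlgebra (R : Type*) {H : Type*} [CommRing R] [AddCommGroup H] [Module R H]
    (mul : H →ₗ[R] H →ₗ[R] H) (one : H) (comul : H →ₗ[R] H ⊗[R] H) (counit : H →ₗ[R] R)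
    (antipode : H →ₗ[R] H) : Prop where
  mul_assoc (a b c : H) : mul (mul a b) c = mul a (mul b c)
  one_mul (a : H) : mul one a = a
  mul_one (a : H) : mul a one = a
  coassoc (a : H) : TensorProduct.assoc R H H H (comul.rTensor H (comul a)) =
    comul.lTensor H (comul a)
  rTensor_counit (a : H) : counit.rTensor H (comul a) = 1 ⊗ₜ[R] a
  lTensor_counit (a : H) : counit.lTensor H (comul a) = a ⊗ₜ[R] 1
  comul_mul (a b : H) : comul (mul a b) = TensorProduct.map₂ mul mul (comul a) (comul b)
  comul_one : comul one = one ⊗ₜ[R] one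
  counit_mul (a b : H) : counit (mul a b) = counit a * counit b
  counit_one : counit one = 1
  antipode_left (a : H) :
    TensorProduct.lift mul (antipode.rTensor H (comul a)) = counit a • one
  antipode_right (a : H) :
    TensorProduct.lift mul (antipode.lTensor H (comul a)) = counit a • one

namespace TreeLie

/-- The enveloping algebra `U(𝒱₀)` of the Lie algebra `(𝒱, [·,·]_0)`. -/
abbrev U₀ (d : ℕ) : Type := UniversalEnvelopingAlgebra ℝ (TreeLie d)

/-- The enveloping algebra `U(𝒱)` of the Lie algebra `(𝒱, [[·,·]])`, where
`[[x, y]] = [x, y]_0 + x ▷̂ y - y ▷̂ x`. -/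
abbrev UBar (d : ℕ) : Type := UniversalEnvelopingAlgebra ℝ (PostLieBar ℝ (TreeLie d))

/-- The monomial `X_0^{m_0} ⋯ X_d^{m_d} I_{a_1}(σ_1) ⋯ I_{a_n}(σ_n)` in `U(𝒱₀)`. -/
noncomputable def monomial {d : ℕ} (m : MultiIdx d) (F : List (Planted d)) : U₀ d :=
  (List.ofFn fun i => UniversalEnvelopingAlgebra.ι ℝ (X i : TreeLie d) ^ m i).prod *
    (F.map fun p => UniversalEnvelopingAlgebra.ι ℝ (planted p)).prod

end TreeLie

/-! ### Maps out of an enveloping algebra -/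

namespace UniversalEnvelopingAlgebra

variable {R L : Type*} [CommRing R] [LieRing L] [LieAlgebra R L]

local notation "𝒰" => UniversalEnvelopingAlgebra R L

/-! Let `𝒰` and `𝒱` be the enveloping algebras of the first and the second bracket of a post-Lie
algebra. By the post-Lie axioms every x acts on `𝒰` by a derivation D_x (`triDer`), and [D_x, D_y] =
D_{[[x,y]]}. Hence the operators M_x = (left multiplication by x) + D_x satisfy [M_x, M_y] =
M_{[[x,y]]} as well (`starDer_bracket`), and `𝒱` acts on `𝒰` in two ways. Evaluating the second
action at 1 gives `toStar : 𝒱 → 𝒰`, a coalgebra map because M_x is the multiplication by a primitive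
element plus a coderivation. Once `toStar` is bijective, A ▷ B can be defined as the first action of
the preimage of A on B; `starAct_eq` then says that `*` is the transported product, and the Hopf
structure of `𝒱` comes along.

Bijectivity needs neither filtrations nor a PBW theorem: the inverse is built by the same recipe in
the other direction. Carried over to `𝒱`, the operator D_x has to satisfy D_x(y b) = (x ▷ y) b + y
D_x(b) + D_{[x,y] - y ▷ x}(b) (`barDer_ιBar_mul`). This is the rule of an induced module: x ▷ y and
x ◁ y = [x,y] - y ▷ x form a matched pair of (L, [[·,·]]) with itself, and D is the action of one
copy on the enveloping algebra of the other. The operators N_x = (left multiplication by x) - D_x on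
`𝒱` satisfy [N_x, N_y] = N_{[x,y]}, so `𝒰` acts on `𝒱`, and evaluation at 1 gives `ofStar`. The two
maps are mutually inverse because both intertwine the operators D_x.

Uniqueness: the rule for xA ▷ y says that (x * A) ▷ y = x ▷ (A ▷ y), which determines A ▷ y for
every A since `toStar` is onto. The rule for BC reduces the second argument to elements of L and to
1, and A ▷ 1 = ε(A) 1 is forced by `eq_counit_of_idempotent`.

For trees, (𝒱, [·,·]_0) is a semidirect product of two abelian Lie algebras, spanned by the planted
trees and by the X_i. The ordered monomials span, since an X_i can be moved to the left at the cost
of planted trees. They are independent, since the enveloping algebra acts from the right on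
polynomials in such a way that an ordered monomial sends 1 to the commutative monomial with the same
factors. -/

theorem ι_lie (x y : L) : ι R ⁅x, y⁆ = ι R x * ι R y - ι R y * ι R x := by
  let _ : LieRing 𝒰 := LieRing.ofAssociativeRing
  exact (ι R).map_lie x y

variable (R L) in
/-- The canonical map to the enveloping algebra, as a linear map. -/
noncomputable def ιLinear : L →ₗ[R] 𝒰 :=
  letI : LieRing 𝒰 := LieRing.ofAssociativeRing
  (ι R : L →ₗ⁅R⁆ 𝒰).toLinearMap

/-- The enveloping algebra is spanned by the products of elements of `L`. -/
theorem ι_mul_induction {p : 𝒰 → Prop} (a : 𝒰) (one : p 1) (smul : ∀ (r : R) a, p a → p (r • a))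
    (add : ∀ a b, p a → p b → p (a + b)) (ι_mul : ∀ x a, p a → p (ι R x * a)) : p a := by
  -- Unlike `p` itself, the property "left multiplication by `a` preserves `p`" is visibly stable
  -- under products in `a`.
  suffices h : ∀ b, p b → p (a * b) by simpa using h 1 one
  induction a using UniversalEnvelopingAlgebra.induction with
  | hR r => exact fun b hb => by rw [← Algebra.smul_def]; exact smul r b hb
  | hι x => exact ι_mul x
  | hadd a b ha hb => exact fun c hc => by rw [add_mul]; exact add _ _ (ha c hc) (hb c hc)
  | hmul a b ha hb => exact fun c hc => by rw [mul_assoc]; exact ha _ (hb c hc)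

theorem derivation_ext {f g : 𝒰 →ₗ[R] 𝒰} (hf : ∀ a b, f (a * b) = f a * b + a * f b)
    (hg : ∀ a b, g (a * b) = g a * b + a * g b) (h : ∀ x, f (ι R x) = g (ι R x)) : f = g := by
  have hf1 : f 1 = 0 := by simpa using hf 1 1
  have hg1 : g 1 = 0 := by simpa using hg 1 1
  refine LinearMap.ext fun a => ?_
  induction a using ι_mul_induction with
  | one => rw [hf1, hg1]
  | smul r a h => rw [map_smul, map_smul, h]
  | add a b ha hb => rw [map_add, map_add, ha, hb]
  | ι_mul x a ha => rw [hf, hg, h, ha]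

/-- The algebra morphism which extends a linear map that turns brackets into commutators. -/
noncomputable def liftLinear {A : Type*} [Ring A] [Algebra R A] (f : L →ₗ[R] A)
    (hf : ∀ x y, f ⁅x, y⁆ = f x * f y - f y * f x) : 𝒰 →ₐ[R] A :=
  letI : LieRing A := LieRing.ofAssociativeRing
  lift R { f with map_lie' := fun {x y} => hf x y }

theorem liftLinear_ι {A : Type*} [Ring A] [Algebra R A] (f : L →ₗ[R] A)
    (hf : ∀ x y, f ⁅x, y⁆ = f x * f y - f y * f x) (x : L) :
    liftLinear f hf (ι R x) = f x :=
  letI : LieRing A := LieRing.ofAssociativeRing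
  lift_ι_apply R _ x

theorem comul_ι_mul (x : L) (a : 𝒰) : Coalgebra.comul (R := R) (ι R x * a) =
    (ι R x ⊗ₜ[R] 1 + 1 ⊗ₜ[R] ι R x) * Coalgebra.comul (R := R) a := by
  rw [Bialgebra.comul_mul, comul_ι]

theorem counit_ι_mul (x : L) (a : 𝒰) : Coalgebra.counit (R := R) (ι R x * a) = 0 := by
  rw [Bialgebra.counit_mul, counit_ι, zero_mul]

theorem commute_ι {x y : L} (h : ⁅x, y⁆ = 0) : Commute (ι R x) (ι R y) := by
  have := ι_lie (R := R) x y
  rw [h, map_zero] at this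
  exact (sub_eq_zero.1 this.symm)

/-- The algebra morphism `a ↦ a + ε D(a)`, where `D` extends the derivation `δ`. -/
noncomputable def dualNumberHom (δ : L →ₗ[R] L) (hδ : ∀ x y, δ ⁅x, y⁆ = ⁅δ x, y⁆ + ⁅x, δ y⁆) :
    𝒰 →ₐ[R] TrivSqZeroExt 𝒰 𝒰 :=
  liftLinear
    { toFun := fun x => TrivSqZeroExt.inl (ι R x) + TrivSqZeroExt.inr (ι R (δ x))
      map_add' := fun x y => by
        simp only [map_add, TrivSqZeroExt.inl_add, TrivSqZeroExt.inr_add]; abel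
      map_smul' := fun r x => by
        simp only [map_smul, TrivSqZeroExt.inl_smul, TrivSqZeroExt.inr_smul, smul_add,
          RingHom.id_apply] }
    (fun x y => by
      ext
      · simp [ι_lie, -ι_apply, -LieHom.map_lie]
      -- As ε² = 0, the ε-part of the commutator of x + ε δx and y + ε δy is [δx, y] + [x, δy]; this
      -- is where `hδ` enters.
      · simp [ι_lie, hδ, -ι_apply, -DualNumber.inr_eq_smul_eps, -LieHom.map_lie]; abel)

theorem fst_dualNumberHom (δ : L →ₗ[R] L) (hδ : ∀ x y, δ ⁅x, y⁆ = ⁅δ x, y⁆ + ⁅x, δ y⁆) (a : 𝒰) :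
    (dualNumberHom δ hδ a).fst = a := by
  have h : (TrivSqZeroExt.fstHom R 𝒰 𝒰).comp (dualNumberHom δ hδ) = AlgHom.id R 𝒰 :=
    algHom_ext fun x => by simp [dualNumberHom, liftLinear_ι, -ι_apply, -DualNumber.inr_eq_smul_eps]
  exact DFunLike.congr_fun h a

/-- The extension of a derivation of a Lie algebra to a derivation of its enveloping algebra. -/
noncomputable def extendDer (δ : L →ₗ[R] L) (hδ : ∀ x y, δ ⁅x, y⁆ = ⁅δ x, y⁆ + ⁅x, δ y⁆) :
    𝒰 →ₗ[R] 𝒰 where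
  toFun a := (dualNumberHom δ hδ a).snd
  map_add' a b := by rw [map_add, TrivSqZeroExt.snd_add]
  map_smul' r a := by rw [map_smul, TrivSqZeroExt.snd_smul, RingHom.id_apply]

variable (δ : L →ₗ[R] L) (hδ : ∀ x y, δ ⁅x, y⁆ = ⁅δ x, y⁆ + ⁅x, δ y⁆)

theorem extendDer_apply (a : 𝒰) : extendDer δ hδ a = (dualNumberHom δ hδ a).snd := rfl

theorem extendDer_mul (a b : 𝒰) :
    extendDer δ hδ (a * b) = extendDer δ hδ a * b + a * extendDer δ hδ b := by
  simp only [extendDer_apply, map_mul, TrivSqZeroExt.snd_mul, fst_dualNumberHom, smul_eq_mul,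
    MulOpposite.smul_eq_mul_unop, MulOpposite.unop_op]
  abel

theorem extendDer_one : extendDer δ hδ (1 : 𝒰) = 0 := by
  rw [extendDer_apply, map_one, TrivSqZeroExt.snd_one]

theorem extendDer_ι (x : L) : extendDer δ hδ (ι R x) = ι R (δ x) := by
  simp [extendDer_apply, dualNumberHom, liftLinear_ι, -ι_apply, -DualNumber.inr_eq_smul_eps]

end UniversalEnvelopingAlgebra

/-! ### Two actions of the enveloping algebra of the second bracket -/

namespace PostLieAlgebra

open UniversalEnvelopingAlgebra (ι ιLinear ι_lie derivation_ext ι_mul_induction liftLinear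
  liftLinear_ι extendDer extendDer_mul extendDer_one extendDer_ι comul_ι_mul counit_ι_mul)

variable {R L : Type*} [CommRing R] [LieRing L] [LieAlgebra R L]

local notation "𝒰" => UniversalEnvelopingAlgebra R L

variable [PostLieAlgebra R L]

local notation "𝒱" => UniversalEnvelopingAlgebra R (PostLieBar R L)
local notation:75 x:76 " ▷ " y:76 => tri (R := R) x y

variable (R) in
/-- The canonical map of a post-Lie algebra to the enveloping algebra of its second bracket. -/
noncomputable def ιBar : L →ₗ[R] 𝒱 :=
  ιLinear R (PostLieBar R L) ∘ₗ (PostLieBar.of R L).toLinearMap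

theorem ι_of (x : L) : ι R (PostLieBar.of R L x) = ιBar R x := rfl

theorem ιBar_bracket (x y : L) : ιBar R (⁅x, y⁆ + x ▷ y - y ▷ x) =
    ιBar R x * ιBar R y - ιBar R y * ιBar R x := by
  rw [← ι_of, ← PostLieBar.of_lie, ι_lie, ι_of, ι_of]

theorem ιBar_mul_induction {p : 𝒱 → Prop} (a : 𝒱) (one : p 1)
    (smul : ∀ (r : R) a, p a → p (r • a)) (add : ∀ a b, p a → p b → p (a + b))
    (ι_mul : ∀ x a, p a → p (ιBar R x * a)) : p a :=
  ι_mul_induction a one smul add fun x => ι_mul ((PostLieBar.of R L).symm x)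

theorem comul_ιBar_mul (x : L) (a : 𝒱) : Coalgebra.comul (R := R) (ιBar R x * a) =
    (ιBar R x ⊗ₜ[R] 1 + 1 ⊗ₜ[R] ιBar R x) * Coalgebra.comul (R := R) a :=
  comul_ι_mul _ a

theorem counit_ιBar_mul (x : L) (a : 𝒱) : Coalgebra.counit (R := R) (ιBar R x * a) = 0 :=
  counit_ι_mul _ a

/-- The algebra morphism which extends a linear map that turns the second bracket into
commutators. -/
noncomputable def liftBar {A : Type*} [Ring A] [Algebra R A] (f : L →ₗ[R] A)
    (hf : ∀ x y, f (⁅x, y⁆ + x ▷ y - y ▷ x) = f x * f y - f y * f x) : 𝒱 →ₐ[R] A :=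
  liftLinear (f ∘ₗ (PostLieBar.of R L).symm.toLinearMap) fun x y => by
    obtain ⟨x, rfl⟩ := (PostLieBar.of R L).surjective x
    obtain ⟨y, rfl⟩ := (PostLieBar.of R L).surjective y
    simpa only [PostLieBar.of_lie, LinearMap.comp_apply, LinearEquiv.coe_coe,
      LinearEquiv.symm_apply_apply] using hf x y

theorem liftBar_ιBar {A : Type*} [Ring A] [Algebra R A] (f : L →ₗ[R] A)
    (hf : ∀ x y, f (⁅x, y⁆ + x ▷ y - y ▷ x) = f x * f y - f y * f x) (x : L) :
    liftBar f hf (ιBar R x) = f x :=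
  liftLinear_ι _ _ _

variable (R) in
/-- The derivation `A ↦ x ▷ A` of the enveloping algebra. -/
noncomputable def triDer : L →ₗ[R] Module.End R 𝒰 where
  toFun x := extendDer (tri x) (tri_lie x)
  map_add' x y := derivation_ext (extendDer_mul _ _)
    (fun a b => by simp only [LinearMap.add_apply, extendDer_mul, add_mul, mul_add]; abel)
    (fun z => by simp only [LinearMap.add_apply, extendDer_ι, map_add])
  map_smul' r x := derivation_ext (extendDer_mul _ _)
    (fun a b => by simp only [RingHom.id_apply, LinearMap.smul_apply, extendDer_mul, smul_add,
      smul_mul_assoc, mul_smul_comm])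
    (fun z => by simp only [RingHom.id_apply, LinearMap.smul_apply, extendDer_ι, map_smul])

theorem triDer_mul (x : L) (a b : 𝒰) :
    triDer R x (a * b) = triDer R x a * b + a * triDer R x b :=
  extendDer_mul _ _ a b

theorem triDer_one (x : L) : triDer R x (1 : 𝒰) = 0 := extendDer_one _ _

theorem triDer_ι (x y : L) : triDer R x (ι R y) = ι R (x ▷ y) := extendDer_ι _ _ y

/-- Both sides are derivations, so it suffices to compare them on L. There, `lie_tri` writes [x,y] ▷
z as a difference of associators, and the other two terms of the second bracket remove (x ▷ y) ▷ z
and (y ▷ x) ▷ z. -/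
theorem triDer_bracket (x y : L) : triDer R (⁅x, y⁆ + x ▷ y - y ▷ x) =
    triDer R x * triDer R y - triDer R y * triDer R x := by
  refine derivation_ext (triDer_mul _) (fun a b => ?_) (fun z => ?_)
  · simp only [LinearMap.sub_apply, Module.End.mul_apply, triDer_mul, map_add]
    noncomm_ring
  · have hz : (⁅x, y⁆ + x ▷ y - y ▷ x) ▷ z = x ▷ (y ▷ z) - y ▷ (x ▷ z) := by
      simp only [map_add, map_sub, LinearMap.add_apply, LinearMap.sub_apply, lie_tri]; abel
    rw [triDer_ι, hz, map_sub]
    simp only [LinearMap.sub_apply, Module.End.mul_apply, triDer_ι]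

variable (R) in
/-- The operator `A ↦ x A + x ▷ A` on the enveloping algebra. -/
noncomputable def starDer : L →ₗ[R] Module.End R 𝒰 :=
  LinearMap.mul R 𝒰 ∘ₗ ιLinear R L + triDer R

theorem starDer_apply (x : L) (a : 𝒰) : starDer R x a = ι R x * a + triDer R x a := rfl

/-- By the Leibniz rule, the mixed terms x (y ▷ a) and y (x ▷ a) cancel in the commutator. What
remains is the multiplication by [x,y] + x ▷ y - y ▷ x and the commutator of the two derivations. -/
theorem starDer_bracket (x y : L) : starDer R (⁅x, y⁆ + x ▷ y - y ▷ x) =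
    starDer R x * starDer R y - starDer R y * starDer R x := by
  refine LinearMap.ext fun a => ?_
  have h := LinearMap.congr_fun (triDer_bracket (R := R) x y) a
  simp only [LinearMap.sub_apply, Module.End.mul_apply] at h
  simp only [LinearMap.sub_apply, Module.End.mul_apply, starDer_apply, h, map_add, triDer_mul,
    triDer_ι]
  rw [map_sub (ι R), map_add (ι R), ι_lie]
  noncomm_ring

variable (R L) in
/-- The action by derivations of the enveloping algebra of the second bracket. -/
noncomputable def triAct : 𝒱 →ₐ[R] Module.End R 𝒰 := liftBar (triDer R) triDer_bracket

variable (R L) in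
/-- The action by left multiplications for the product `*`. -/
noncomputable def starAct : 𝒱 →ₐ[R] Module.End R 𝒰 := liftBar (starDer R) starDer_bracket

theorem triAct_ιBar_mul (x : L) (a : 𝒱) (B : 𝒰) :
    triAct R L (ιBar R x * a) B = triDer R x (triAct R L a B) := by
  rw [map_mul, triAct, liftBar_ιBar, Module.End.mul_apply]

theorem starAct_ιBar_mul (x : L) (a : 𝒱) (B : 𝒰) :
    starAct R L (ιBar R x * a) B = ι R x * starAct R L a B + triDer R x (starAct R L a B) := by
  rw [map_mul, starAct, liftBar_ιBar, Module.End.mul_apply, starDer_apply]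

theorem triAct_one (B : 𝒰) : triAct R L 1 B = B := by rw [map_one, Module.End.one_apply]

theorem starAct_one (B : 𝒰) : starAct R L 1 B = B := by rw [map_one, Module.End.one_apply]

variable (R L) in
/-- The map between the enveloping algebras of the two brackets which turns the product into `*`. -/
noncomputable def toStar : 𝒱 →ₗ[R] 𝒰 := (starAct R L).toLinearMap.flip 1

theorem toStar_apply (a : 𝒱) : toStar R L a = starAct R L a 1 := rfl

theorem toStar_one : toStar R L 1 = 1 := starAct_one 1

theorem toStar_ιBar_mul (x : L) (a : 𝒱) :
    toStar R L (ιBar R x * a) = ι R x * toStar R L a + triDer R x (toStar R L a) :=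
  starAct_ιBar_mul x a 1

theorem toStar_ιBar (x : L) : toStar R L (ιBar R x) = ι R x := by
  simpa [toStar_one, triDer_one, -UniversalEnvelopingAlgebra.ι_apply]
    using toStar_ιBar_mul (R := R) x 1

theorem toStar_mul (a b : 𝒱) : toStar R L (a * b) = starAct R L a (toStar R L b) := by
  rw [toStar_apply, map_mul, Module.End.mul_apply, toStar_apply]

/-! ### Compatibility with the coproduct -/

/-- A derivation which maps the primitive generators to primitive elements is a coderivation. -/
theorem comul_triDer (x : L) (a : 𝒰) : Coalgebra.comul (R := R) (triDer R x a) =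
    (triDer R x).rTensor 𝒰 (Coalgebra.comul (R := R) a) +
      (triDer R x).lTensor 𝒰 (Coalgebra.comul (R := R) a) := by
  induction a using ι_mul_induction with
  | one => simp [triDer_one, Algebra.TensorProduct.one_def]
  | smul r a h => simp only [map_smul, h, smul_add]
  | add a b ha hb => simp only [map_add, ha, hb]; abel
  | ι_mul y a h =>
    rw [triDer_mul, map_add, triDer_ι, comul_ι_mul, comul_ι_mul, comul_ι_mul, h]
    -- The remaining identity is linear in Δ(a) and holds for an arbitrary tensor, so it can be
    -- checked on pure ones.
    generalize Coalgebra.comul (R := R) a = t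
    induction t with
    | zero => simp
    | add t u ht hu => 
      simp only [mul_add, map_add] at ht hu ⊢
      linear_combination (norm := abel) ht + hu
    | tmul p q =>
      simp only [add_mul, mul_add, Algebra.TensorProduct.tmul_mul_tmul, one_mul, map_add,
        LinearMap.rTensor_tmul, LinearMap.lTensor_tmul, triDer_mul, triDer_ι,
        TensorProduct.add_tmul, TensorProduct.tmul_add]
      abel

/-- Multiplication by a primitive x, and the coderivation x ▷, both pass through Δ as (· ⊗ 1 + 1 ⊗
·). So does their sum, just like the left multiplication by x in `𝒱`. -/
theorem comul_toStar (a : 𝒱) : Coalgebra.comul (R := R) (toStar R L a) =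
    TensorProduct.map (toStar R L) (toStar R L) (Coalgebra.comul (R := R) a) := by
  induction a using ιBar_mul_induction with
  | one => simp [toStar_one, Algebra.TensorProduct.one_def]
  | smul r a h => simp only [map_smul, h]
  | add a b ha hb => simp only [map_add, ha, hb]
  | ι_mul x a h =>
    rw [toStar_ιBar_mul, map_add, comul_ι_mul, comul_triDer, comul_ιBar_mul, h]
    generalize Coalgebra.comul (R := R) a = t
    induction t with
    | zero => simp
    | add t u ht hu => simp only [mul_add, map_add, ← ht, ← hu]; abel
    | tmul p q =>
      simp only [add_mul, Algebra.TensorProduct.tmul_mul_tmul, one_mul, map_add,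
        TensorProduct.map_tmul, LinearMap.rTensor_tmul, LinearMap.lTensor_tmul, toStar_ιBar_mul,
        TensorProduct.add_tmul, TensorProduct.tmul_add]
      abel

theorem counit_triDer (x : L) (a : 𝒰) : Coalgebra.counit (R := R) (triDer R x a) = 0 := by
  induction a using ι_mul_induction with
  | one => simp only [triDer_one, map_zero]
  | smul r a h => simp only [map_smul, h, smul_zero]
  | add a b ha hb => simp only [map_add, ha, hb, add_zero]
  | ι_mul y a h => simp only [triDer_mul, triDer_ι, map_add, counit_ι_mul, add_zero]

theorem counit_toStar (a : 𝒱) :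
    Coalgebra.counit (R := R) (toStar R L a) = Coalgebra.counit (R := R) a := by
  induction a using ιBar_mul_induction with
  | one => simp [toStar_one]
  | smul r a h => simp only [map_smul, h]
  | add a b ha hb => simp only [map_add, ha, hb]
  | ι_mul x a h =>
    rw [toStar_ιBar_mul, map_add, counit_ι_mul, counit_triDer, counit_ιBar_mul, add_zero]

/-- The generators are primitive and act by derivations, which makes `𝒰` a module algebra over the
Hopf algebra `𝒱`. -/
theorem triAct_mul (a : 𝒱) (B C : 𝒰) : triAct R L a (B * C) = LinearMap.mul' R 𝒰
    (TensorProduct.map ((triAct R L).toLinearMap.flip B) ((triAct R L).toLinearMap.flip C)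
      (Coalgebra.comul (R := R) a)) := by
  induction a using ιBar_mul_induction with
  | one => simp [Algebra.TensorProduct.one_def]
  | smul r a h => simp only [map_smul, LinearMap.smul_apply, h]
  | add a b ha hb => simp only [map_add, LinearMap.add_apply, ha, hb]
  | ι_mul x a h =>
    rw [triAct_ιBar_mul, comul_ιBar_mul, h]
    generalize Coalgebra.comul (R := R) a = t
    induction t with
    | zero => simp
    | add t u ht hu => simp only [mul_add, map_add, ht, hu]
    | tmul p q =>
      simp only [add_mul, Algebra.TensorProduct.tmul_mul_tmul, one_mul, map_add,
        TensorProduct.map_tmul, LinearMap.mul'_apply, LinearMap.flip_apply,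
        AlgHom.toLinearMap_apply, triAct_ιBar_mul, triDer_mul]

/-- This is the formula for `*`, with its first argument still in `𝒱`. Applying x · + x ▷ to a
product P Q gives (xP + x ▷ P) Q + P (x ▷ Q): the first term lets x act in the `toStar` leg of the
coproduct, the second one in the other leg. -/
theorem starAct_eq (a : 𝒱) (B : 𝒰) : starAct R L a B = LinearMap.mul' R 𝒰
    (TensorProduct.map (toStar R L) ((triAct R L).toLinearMap.flip B)
      (Coalgebra.comul (R := R) a)) := by
  induction a using ιBar_mul_induction with
  | one => simp [Algebra.TensorProduct.one_def, toStar_one]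
  | smul r a h => simp only [map_smul, LinearMap.smul_apply, h]
  | add a b ha hb => simp only [map_add, LinearMap.add_apply, ha, hb]
  | ι_mul x a h =>
    rw [starAct_ιBar_mul, comul_ιBar_mul, h]
    generalize Coalgebra.comul (R := R) a = t
    induction t with
    | zero => simp
    | add t u ht hu => simp only [mul_add, map_add, ← ht, ← hu]; abel
    | tmul p q =>
      simp only [add_mul, Algebra.TensorProduct.tmul_mul_tmul, one_mul, map_add,
        TensorProduct.map_tmul, LinearMap.mul'_apply, LinearMap.flip_apply,
        AlgHom.toLinearMap_apply, triAct_ιBar_mul, toStar_ιBar_mul, triDer_mul, mul_assoc]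
      abel

end PostLieAlgebra

/-! ### Invertibility of the map between the two enveloping algebras -/

namespace PostLieAlgebra

open UniversalEnvelopingAlgebra (ι ι_mul_induction liftLinear liftLinear_ι)

variable {R L : Type*} [CommRing R] [LieRing L] [LieAlgebra R L]

local notation "𝒰" => UniversalEnvelopingAlgebra R L

variable [PostLieAlgebra R L]

local notation "𝒱" => UniversalEnvelopingAlgebra R (PostLieBar R L)
local notation:75 x:76 " ▷ " y:76 => tri (R := R) x y

variable (R) in
/-- The linear map `x ↦ [x, y] - y ▷ x`. -/
noncomputable def coTri : L →ₗ[R] L →ₗ[R] L :=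
  LinearMap.mk₂ R (fun y x => ⁅x, y⁆ - y ▷ x)
    (fun x y z => by simp only [lie_add, map_add, LinearMap.add_apply]; abel)
    (fun r x y => by simp only [lie_smul, map_smul, LinearMap.smul_apply, smul_sub])
    (fun x y z => by simp only [add_lie, map_add]; abel)
    (fun r x y => by simp only [smul_lie, map_smul, smul_sub])

theorem coTri_apply (y x : L) : coTri R y x = ⁅x, y⁆ - y ▷ x := rfl

/-- With x ◁ y = `coTri R y x`, this says that ◁ is a right action of the second bracket. The next
two lemmas are the compatibility conditions between ◁ and ▷ in a matched pair of Lie algebras. -/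
theorem coTri_bracket (x y z : L) : coTri R (⁅y, z⁆ + y ▷ z - z ▷ y) x =
    coTri R z (coTri R y x) - coTri R y (coTri R z x) := by
  have h : ⁅⁅x, y⁆, z⁆ - ⁅⁅x, z⁆, y⁆ = ⁅x, ⁅y, z⁆⁆ := by
    rw [leibniz_lie x y z, ← lie_skew ⁅x, z⁆ y]; abel
  simp only [coTri_apply, map_add, map_sub, LinearMap.add_apply,
    LinearMap.sub_apply, tri_lie, lie_tri]
  linear_combination (norm := abel) -h

theorem coTri_bracket_right (x y z : L) : coTri R z (⁅x, y⁆ + x ▷ y - y ▷ x) =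
    (⁅coTri R z x, y⁆ + coTri R z x ▷ y - y ▷ coTri R z x) +
      (⁅x, coTri R z y⁆ + x ▷ coTri R z y - coTri R z y ▷ x) +
      (coTri R (y ▷ z) x - coTri R (x ▷ z) y) := by
  have h : ⁅⁅x, z⁆, y⁆ + ⁅x, ⁅y, z⁆⁆ = ⁅⁅x, y⁆, z⁆ := by
    rw [leibniz_lie x y z, ← lie_skew ⁅x, z⁆ y]; abel
  simp only [coTri_apply, lie_sub, sub_lie, map_add, map_sub, LinearMap.sub_apply,
    tri_lie, lie_tri]
  linear_combination (norm := abel) -h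

theorem tri_bracket (x y z : L) : x ▷ (⁅y, z⁆ + y ▷ z - z ▷ y) =
    (⁅x ▷ y, z⁆ + (x ▷ y) ▷ z - z ▷ (x ▷ y)) + (⁅y, x ▷ z⁆ + y ▷ (x ▷ z) - (x ▷ z) ▷ y) +
      (coTri R y x ▷ z - coTri R z x ▷ y) := by
  simp only [coTri_apply, map_add, map_sub, LinearMap.sub_apply, tri_lie, lie_tri]
  abel

variable (R L) in
/-- The operators `(b, φ) ↦ (y b, x ↦ (x ▷ y) b + y φ(x) + φ([x, y] - y ▷ x))`. -/
noncomputable def twist : L →ₗ[R] Module.End R (𝒱 × (L →ₗ[R] 𝒱)) :=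
  LinearMap.mk₂ R (fun y p => (ιBar R y * p.1,
      (LinearMap.mul R 𝒱).flip p.1 ∘ₗ ιBar R ∘ₗ (tri (R := R)).flip y +
        LinearMap.mul R 𝒱 (ιBar R y) ∘ₗ p.2 + p.2 ∘ₗ coTri R y))
    (fun y z p => by ext <;> simp [add_mul]; abel)
    (fun r y p => by ext <;> simp)
    (fun y p q => by ext <;> simp [mul_add]; abel)
    (fun r y p => by ext <;> simp)

theorem fst_twist (y : L) (p : 𝒱 × (L →ₗ[R] 𝒱)) : (twist R L y p).1 = ιBar R y * p.1 := rfl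

theorem snd_twist (y : L) (p : 𝒱 × (L →ₗ[R] 𝒱)) (x : L) : (twist R L y p).2 x =
    ιBar R (x ▷ y) * p.1 + ιBar R y * p.2 x + p.2 (coTri R y x) := rfl

/-- The rule for D_x(y b) is recursive in b, and therefore a priori defined on words only. Carrying
b and φ = (x ↦ D_x b) together turns it into an operator for each y; the commutator relation shows
that the recursion respects the relations of `𝒱`. -/
theorem twist_bracket (y z : L) : twist R L (⁅y, z⁆ + y ▷ z - z ▷ y) =
    twist R L y * twist R L z - twist R L z * twist R L y := by
  refine LinearMap.ext fun p => Prod.ext ?_ (LinearMap.ext fun x => ?_)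
  · simp only [LinearMap.sub_apply, Module.End.mul_apply, Prod.fst_sub, fst_twist, ιBar_bracket]
    noncomm_ring
  · simp only [LinearMap.sub_apply, Module.End.mul_apply, Prod.snd_sub, fst_twist, snd_twist]
    rw [tri_bracket, map_add (ιBar R), map_add (ιBar R), ιBar_bracket, ιBar_bracket, ιBar_bracket,
      coTri_bracket, map_sub, map_sub]
    noncomm_ring

variable (R L) in
/-- The action of the enveloping algebra which extends the operators `twist R L y`. -/
noncomputable def twistAct : 𝒱 →ₐ[R] Module.End R (𝒱 × (L →ₗ[R] 𝒱)) :=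
  liftBar (A := Module.End R (𝒱 × (L →ₗ[R] 𝒱))) (twist R L) twist_bracket

theorem twistAct_ιBar_mul (y : L) (b : 𝒱) (p : 𝒱 × (L →ₗ[R] 𝒱)) :
    twistAct R L (ιBar R y * b) p = twist R L y (twistAct R L b p) := by
  rw [map_mul, twistAct, liftBar_ιBar, Module.End.mul_apply]

/-- The starting pair (1, 0) encodes D_x(1) = 0. As the first component only records b, the second
one obeys the recursion in b alone. -/
theorem fst_twistAct (b : 𝒱) : (twistAct R L b (1, 0)).1 = b := by
  induction b using ιBar_mul_induction with
  | one => rw [map_one, Module.End.one_apply]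
  | smul r a h => rw [map_smul, LinearMap.smul_apply, Prod.smul_fst, h]
  | add a b ha hb => rw [map_add, LinearMap.add_apply, Prod.fst_add, ha, hb]
  | ι_mul x a h => rw [twistAct_ιBar_mul, fst_twist, h]

variable (R) in
/-- The operator `b ↦ x ▷ b`, transported to the enveloping algebra of the second bracket. -/
noncomputable def barDer : L →ₗ[R] Module.End R 𝒱 :=
  (LinearMap.snd R 𝒱 (L →ₗ[R] 𝒱) ∘ₗ (twistAct R L).toLinearMap.flip (1, 0)).flip

theorem barDer_apply (x : L) (b : 𝒱) : barDer R x b = (twistAct R L b (1, 0)).2 x := rfl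

theorem barDer_one (x : L) : barDer R x (1 : 𝒱) = 0 := by
  rw [barDer_apply, map_one, Module.End.one_apply, LinearMap.zero_apply]

theorem barDer_ιBar_mul (x y : L) (b : 𝒱) : barDer R x (ιBar R y * b) =
    ιBar R (x ▷ y) * b + ιBar R y * barDer R x b + barDer R (coTri R y x) b := by
  rw [barDer_apply, twistAct_ιBar_mul, snd_twist, fst_twistAct]; rfl

/-- When both sides are expanded on z b, the new terms are operators of (x ◁ z, y) and (x, y ◁ z) on
b, where x ◁ z = `coTri R z x`. The induction is therefore over all x and y at once, and
`coTri_bracket_right` matches the terms. -/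
theorem barDer_bracket (x y : L) (b : 𝒱) : barDer R (⁅x, y⁆ + x ▷ y - y ▷ x) b =
    barDer R x (barDer R y b) - barDer R y (barDer R x b) := by
  induction b using ιBar_mul_induction generalizing x y with
  | one => simp only [barDer_one, map_zero, sub_zero]
  | smul r b h => simp only [map_smul, h, smul_sub]
  | add a b ha hb => rw [map_add, ha, hb]; simp only [map_add]; abel
  | ι_mul z b h =>
    have h1 := h (coTri R z x) y
    have h2 := h x (coTri R z y)
    have hz : (⁅x, y⁆ + x ▷ y - y ▷ x) ▷ z = x ▷ (y ▷ z) - y ▷ (x ▷ z) := by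
      simp only [map_add, map_sub, LinearMap.add_apply, LinearMap.sub_apply, lie_tri]; abel
    simp only [barDer_ιBar_mul, map_add]
    rw [coTri_bracket_right, map_add (barDer R), map_add (barDer R), LinearMap.add_apply,
      LinearMap.add_apply, h1, h2, hz, h x y, map_sub (barDer R), LinearMap.sub_apply, map_sub]
    noncomm_ring

variable (R) in
/-- The operator `b ↦ x b - x ▷ b`. -/
noncomputable def unstarDer : L →ₗ[R] Module.End R 𝒱 :=
  LinearMap.mul R 𝒱 ∘ₗ ιBar R - barDer R

theorem unstarDer_apply (x : L) (b : 𝒱) : unstarDer R x b = ιBar R x * b - barDer R x b := rfl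

/-- On `𝒱` the operator N_y = `unstarDer R y` stands for the multiplication by y in `𝒰`; so this is
the untwisted Leibniz rule of x ▷. The twist `coTri` is absorbed by the commutator of `barDer R x`
and `barDer R y`. -/
theorem barDer_unstarDer (x y : L) (b : 𝒱) : barDer R x (unstarDer R y b) =
    unstarDer R (x ▷ y) b + unstarDer R y (barDer R x b) := by
  have h := barDer_bracket (R := R) x y b
  simp only [unstarDer_apply, map_sub, map_add, LinearMap.sub_apply, LinearMap.add_apply,
    barDer_ιBar_mul, coTri_apply] at h ⊢
  linear_combination (norm := abel) h

/-- The commutator of left multiplications contributes [[x,y]]. Moving the operators D past N and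
past multiplications contributes terms in x ▷ y and y ▷ x, which remove the post-Lie part and leave
the first bracket. -/
theorem unstarDer_bracket (x y : L) : unstarDer R ⁅x, y⁆ =
    unstarDer R x * unstarDer R y - unstarDer R y * unstarDer R x := by
  refine LinearMap.ext fun b => ?_
  simp only [LinearMap.sub_apply, Module.End.mul_apply]
  have h := congrArg (· * b) (ιBar_bracket (R := R) x y)
  have hs : barDer R ⁅y, x⁆ b = -barDer R ⁅x, y⁆ b := by
    rw [← lie_skew, map_neg, LinearMap.neg_apply]
  rw [unstarDer_apply x, unstarDer_apply y (unstarDer R x b), barDer_unstarDer]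
  simp only [unstarDer_apply, map_sub, map_add, LinearMap.sub_apply, barDer_ιBar_mul, coTri_apply,
    hs, mul_sub, add_mul, sub_mul, mul_assoc] at h ⊢
  linear_combination (norm := abel) h

variable (R L) in
/-- The action of the enveloping algebra of the first bracket on that of the second one. -/
noncomputable def unstarAct : 𝒰 →ₐ[R] Module.End R 𝒱 :=
  liftLinear (unstarDer R) unstarDer_bracket

variable (R L) in
/-- The inverse of `toStar`. -/
noncomputable def ofStar : 𝒰 →ₗ[R] 𝒱 := (unstarAct R L).toLinearMap.flip 1

theorem ofStar_one : ofStar R L 1 = 1 := by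
  change unstarAct R L 1 1 = 1
  rw [map_one (unstarAct R L), Module.End.one_apply]

theorem ofStar_ι_mul (x : L) (A : 𝒰) :
    ofStar R L (ι R x * A) = ιBar R x * ofStar R L A - barDer R x (ofStar R L A) := by
  change unstarAct R L (ι R x * A) 1 = _
  rw [map_mul, unstarAct, liftLinear_ι, Module.End.mul_apply]; rfl

theorem ofStar_triDer (x : L) (A : 𝒰) :
    ofStar R L (triDer R x A) = barDer R x (ofStar R L A) := by
  induction A using ι_mul_induction with
  | one => rw [triDer_one, map_zero, ofStar_one, barDer_one]
  | smul r a h => simp only [map_smul, h]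
  | add a b ha hb => simp only [map_add, ha, hb]
  | ι_mul y a h =>
    rw [triDer_mul, triDer_ι, map_add, ofStar_ι_mul, ofStar_ι_mul, ofStar_ι_mul, h]
    exact (barDer_unstarDer x y _).symm

/-- Moving D_x past M_y in `𝒰` produces [D_x, D_y] = D_{[[x,y]]}, whose summand D_{x ▷ y} completes
the multiplication by x ▷ y to M_{x ▷ y}. The rest is the `coTri` term of `barDer_ιBar_mul`; it
changes x, hence the generalization. -/
theorem toStar_barDer (x : L) (b : 𝒱) :
    toStar R L (barDer R x b) = triDer R x (toStar R L b) := by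
  induction b using ιBar_mul_induction generalizing x with
  | one => rw [barDer_one, map_zero, toStar_one, triDer_one]
  | smul r a h => simp only [map_smul, h]
  | add a b ha hb => simp only [map_add, ha, hb]
  | ι_mul y b h =>
    have hD := LinearMap.congr_fun (triDer_bracket (R := R) x y) (toStar R L b)
    simp only [LinearMap.sub_apply, Module.End.mul_apply, map_sub, map_add,
      LinearMap.add_apply] at hD
    rw [barDer_ιBar_mul, map_add, map_add, toStar_ιBar_mul, toStar_ιBar_mul, toStar_ιBar_mul, h, h]
    simp only [map_add, triDer_mul, triDer_ι, coTri_apply, map_sub, LinearMap.sub_apply]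
    linear_combination (norm := abel) hD

/-- Thanks to the intertwining of the operators x ▷, the one added by `toStar` cancels the one
subtracted by `ofStar`. -/
theorem ofStar_toStar (a : 𝒱) : ofStar R L (toStar R L a) = a := by
  induction a using ιBar_mul_induction with
  | one => rw [toStar_one, ofStar_one]
  | smul r a h => simp only [map_smul, h]
  | add a b ha hb => simp only [map_add, ha, hb]
  | ι_mul x a h =>
    rw [toStar_ιBar_mul, map_add, ofStar_ι_mul, ofStar_triDer, h, sub_add_cancel]

theorem toStar_ofStar (A : 𝒰) : toStar R L (ofStar R L A) = A := by
  induction A using ι_mul_induction with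
  | one => rw [ofStar_one, toStar_one]
  | smul r a h => simp only [map_smul, h]
  | add a b ha hb => simp only [map_add, ha, hb]
  | ι_mul x a h =>
    rw [ofStar_ι_mul, map_sub, toStar_ιBar_mul, toStar_barDer, h, add_sub_cancel_right]

variable (R L) in
/-- The isomorphism between the enveloping algebras of the two brackets. -/
noncomputable def starEquiv : 𝒱 ≃ₗ[R] 𝒰 :=
  LinearEquiv.ofLinearMap (toStar R L) (ofStar R L) (LinearMap.ext toStar_ofStar)
    (LinearMap.ext ofStar_toStar)

theorem starEquiv_apply (a : 𝒱) : starEquiv R L a = toStar R L a := rfl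

end PostLieAlgebra

/-! ### The extension of the post-Lie product -/

namespace UniversalEnvelopingAlgebra

variable {R L : Type*} [CommRing R] [LieRing L] [LieAlgebra R L]

local notation "𝒰" => UniversalEnvelopingAlgebra R L

theorem linearMap_ext_prod {M : Type*} [AddCommGroup M] [Module R M] {f g : 𝒰 →ₗ[R] M}
    (h : ∀ l : List L, f (l.map (ι R)).prod = g (l.map (ι R)).prod) : f = g := by
  have key : ∀ a : 𝒰, a ∈ Submodule.span R (Set.range fun l : List L => (l.map (ι R)).prod) := by
    intro a
    induction a using ι_mul_induction with
    | one => exact Submodule.subset_span ⟨[], rfl⟩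
    | smul r a h => exact Submodule.smul_mem _ r h
    | add a b ha hb => exact Submodule.add_mem _ ha hb
    | ι_mul x a h =>
      induction h using Submodule.span_induction with
      | mem _ hl => obtain ⟨l, rfl⟩ := hl; exact Submodule.subset_span ⟨x :: l, by simp⟩
      | zero => simp
      | add a b _ _ ha hb => rw [mul_add]; exact Submodule.add_mem _ ha hb
      | smul r a _ ha => rw [mul_smul_comm]; exact Submodule.smul_mem _ r ha
  refine LinearMap.ext_on_range (v := fun l : List L => (l.map (ι R)).prod) ?_ h
  exact eq_top_iff.2 fun a _ => key a

/-- Only the lengths of the two factors matter: they carry the induction in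
`eq_counit_of_idempotent`. -/
theorem comul_prod_mem (l : List L) : Coalgebra.comul (R := R) (l.map (ι R)).prod ∈
    Submodule.span R {t : 𝒰 ⊗[R] 𝒰 | ∃ s s' : List L, s.length + s'.length = l.length ∧
      t = (s.map (ι R)).prod ⊗ₜ[R] (s'.map (ι R)).prod} := by
  induction l with
  | nil => exact Submodule.subset_span ⟨[], [], rfl, by simp [Algebra.TensorProduct.one_def]⟩
  | cons x l ih =>
    rw [List.map_cons, List.prod_cons, comul_ι_mul]
    generalize Coalgebra.comul (R := R) (l.map (ι R)).prod = t at ih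
    induction ih using Submodule.span_induction with
    | zero => rw [mul_zero]; exact Submodule.zero_mem _
    | add a b _ _ ha hb => rw [mul_add]; exact Submodule.add_mem _ ha hb
    | smul r a _ ha => rw [mul_smul_comm]; exact Submodule.smul_mem _ r ha
    | mem _ ht =>
      obtain ⟨s, s', h, rfl⟩ := ht
      rw [add_mul]
      refine Submodule.add_mem _ (Submodule.subset_span ⟨x :: s, s', ?_, ?_⟩)
        (Submodule.subset_span ⟨s, x :: s', ?_, ?_⟩)
      · simp only [List.length_cons]; omega
      · rw [Algebra.TensorProduct.tmul_mul_tmul, one_mul, List.map_cons, List.prod_cons]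
      · simp only [List.length_cons]; omega
      · rw [Algebra.TensorProduct.tmul_mul_tmul, one_mul, List.map_cons, List.prod_cons]

/-- The counit is the only idempotent for the convolution which maps `1` to `1`. -/
theorem eq_counit_of_idempotent (φ : 𝒰 →ₗ[R] 𝒰) (h1 : φ 1 = 1)
    (hφ : ∀ a, φ a = LinearMap.mul' R 𝒰 (TensorProduct.map φ φ (Coalgebra.comul (R := R) a)))
    (a : 𝒰) : φ a = Coalgebra.counit (R := R) a • 1 := by
  set η : 𝒰 →ₗ[R] 𝒰 := (Coalgebra.counit (R := R) (A := 𝒰)).smulRight 1 with hη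
  have hr : ∀ (ψ : 𝒰 →ₗ[R] 𝒰) (a : 𝒰),
      LinearMap.mul' R 𝒰 (TensorProduct.map ψ η (Coalgebra.comul (R := R) a)) = ψ a := by
    intro ψ a
    have h : LinearMap.mul' R 𝒰 ∘ₗ TensorProduct.map ψ η = ψ ∘ₗ
        (TensorProduct.rid R 𝒰).toLinearMap ∘ₗ (Coalgebra.counit (R := R) (A := 𝒰)).lTensor 𝒰 :=
      TensorProduct.ext' fun p q => by simp [hη]
    have h' := LinearMap.congr_fun h (Coalgebra.comul (R := R) a)
    simpa [Coalgebra.lTensor_counit_comul] using h'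
  have hl : ∀ (ψ : 𝒰 →ₗ[R] 𝒰) (a : 𝒰),
      LinearMap.mul' R 𝒰 (TensorProduct.map η ψ (Coalgebra.comul (R := R) a)) = ψ a := by
    intro ψ a
    have h : LinearMap.mul' R 𝒰 ∘ₗ TensorProduct.map η ψ = ψ ∘ₗ
        (TensorProduct.lid R 𝒰).toLinearMap ∘ₗ (Coalgebra.counit (R := R) (A := 𝒰)).rTensor 𝒰 :=
      TensorProduct.ext' fun p q => by simp [hη]
    have h' := LinearMap.congr_fun h (Coalgebra.comul (R := R) a)
    simpa [Coalgebra.rTensor_counit_comul] using h'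
  -- By `hl` and `hr`, η is the unit of the convolution. With φ ⋆ φ = φ, the difference ξ = φ - η
  -- satisfies ξ ⋆ ξ = φ - 2φ + η = -ξ.
  obtain ⟨ξ, hξ⟩ : ∃ ξ, ξ = φ - η := ⟨_, rfl⟩
  have hξ1 : ξ 1 = 0 := by simp [hξ, hη, h1]
  have hξξ : ∀ a, ξ a =
      -LinearMap.mul' R 𝒰 (TensorProduct.map ξ ξ (Coalgebra.comul (R := R) a)) := by
    intro a
    have hm : TensorProduct.map ξ ξ = TensorProduct.map φ φ - TensorProduct.map φ η -
        TensorProduct.map η φ + TensorProduct.map η η :=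
      TensorProduct.ext' fun p q => by
        simp only [hξ, TensorProduct.map_tmul, LinearMap.sub_apply, LinearMap.add_apply,
          TensorProduct.sub_tmul, TensorProduct.tmul_sub]
        abel
    rw [hm]
    simp only [LinearMap.sub_apply, LinearMap.add_apply, map_sub, map_add, hl, hr, ← hφ, hξ]
    abel
  -- In each term of the coproduct of a word, either the second factor is empty and ξ(1) = 0
  -- applies, or the first factor is a shorter word and is killed by induction.
  have hξl : ∀ (n : ℕ) (l : List L), l.length = n → ξ (l.map (ι R)).prod = 0 := by
    intro n
    induction n using Nat.strong_induction_on with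
    | _ n ih =>
      intro l hln
      rw [hξξ, neg_eq_zero]
      have hmem := comul_prod_mem (R := R) l
      generalize Coalgebra.comul (R := R) (l.map (ι R)).prod = t at hmem
      induction hmem using Submodule.span_induction with
      | zero => simp only [map_zero]
      | add a b _ _ ha hb => simp only [map_add, ha, hb, add_zero]
      | smul r a _ ha => simp only [map_smul, ha, smul_zero]
      | mem _ ht =>
        obtain ⟨s, s', h, rfl⟩ := ht
        rw [TensorProduct.map_tmul, LinearMap.mul'_apply]
        rcases s' with _ | ⟨x, s'⟩
        · rw [List.map_nil, List.prod_nil, hξ1, mul_zero]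
        · rw [ih s.length (by simp only [List.length_cons] at h; omega) s rfl, zero_mul]
  have h0 : ξ = 0 := linearMap_ext_prod fun l => hξl _ l rfl
  rw [hξ, sub_eq_zero] at h0
  rw [h0]; rfl

end UniversalEnvelopingAlgebra

namespace PostLieAlgebra

open UniversalEnvelopingAlgebra (ι linearMap_ext_prod eq_counit_of_idempotent)

variable {R L : Type*} [CommRing R] [LieRing L] [LieAlgebra R L]

local notation "𝒰" => UniversalEnvelopingAlgebra R L

variable [PostLieAlgebra R L]

local notation "𝒱" => UniversalEnvelopingAlgebra R (PostLieBar R L)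
local notation:75 x:76 " ▷ " y:76 => tri (R := R) x y

variable (R L) in
/-- The extension of the post-Lie product to the enveloping algebra. -/
noncomputable def triExt : 𝒰 →ₗ[R] 𝒰 →ₗ[R] 𝒰 :=
  (triAct R L).toLinearMap ∘ₗ (starEquiv R L).symm.toLinearMap

theorem triExt_toStar (a : 𝒱) : triExt R L (toStar R L a) = triAct R L a := by
  rw [← starEquiv_apply, triExt, LinearMap.comp_apply, LinearEquiv.coe_coe,
    LinearEquiv.symm_apply_apply, AlgHom.toLinearMap_apply]

theorem exists_toStar (A : 𝒰) : ∃ a : 𝒱, toStar R L a = A := (starEquiv R L).surjective A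

theorem triExt_ι (x : L) : triExt R L (ι R x) = triDer R x := by
  rw [← toStar_ιBar, triExt_toStar, triAct, liftBar_ιBar]

theorem triDer_prod (x : L) (y : List L) : triDer R x (y.map (ι R)).prod =
    ∑ i : Fin y.length, ((y.set i (x ▷ y[i])).map (ι R)).prod := by
  induction y with
  | nil => simp [triDer_one]
  | cons z y ih =>
    rw [List.map_cons, List.prod_cons, triDer_mul, triDer_ι, ih]
    simp only [List.length_cons]
    rw [Fin.sum_univ_succ, Finset.mul_sum]
    simp [-UniversalEnvelopingAlgebra.ι_apply]

/-- For A = `toStar R L a`, the element xA + x ▷ A is the image of xa. The rule for xA ▷ y is thus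
the module axiom of `triAct`, and the rule for BC is `triAct_mul` transported by a coalgebra map. -/
theorem isExtension_triExt : IsExtension (triExt R L) where
  ι_one x := by rw [triExt_ι, triDer_one]
  ι_prod x y := by rw [triExt_ι, triDer_prod]
  one A := by rw [← toStar_one, triExt_toStar, triAct_one]
  ι_mul x A y := by
    obtain ⟨a, rfl⟩ := exists_toStar A
    have h := triAct_ιBar_mul x a (ι R y)
    rw [← triExt_toStar, toStar_ιBar_mul, map_add, LinearMap.add_apply] at h
    rw [triExt_ι, triExt_toStar, ← h, add_sub_cancel_right]
  mul A B C := by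
    obtain ⟨a, rfl⟩ := exists_toStar A
    rw [triExt_toStar, triAct_mul, sweedlerTri, comul_toStar, ← LinearMap.comp_apply
      (TensorProduct.map _ _) (TensorProduct.map _ _), ← TensorProduct.map_comp]
    congr 3 <;> exact LinearMap.ext fun b => by simp [triExt_toStar]

/-! ### Uniqueness of the extension -/

theorem IsExtension.apply_ι {T : 𝒰 →ₗ[R] 𝒰 →ₗ[R] 𝒰} (hT : IsExtension T) (x : L) :
    T (ι R x) = triDer R x :=
  linearMap_ext_prod fun l => by rw [hT.ι_prod, triDer_prod]

/-- The axioms give A ▷ 1 only for A = 1 and for A in L. In general, 1 = 1 · 1 and the rule for BC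
make A ↦ A ▷ 1 an idempotent for the convolution. -/
theorem IsExtension.apply_one {T : 𝒰 →ₗ[R] 𝒰 →ₗ[R] 𝒰} (hT : IsExtension T) (A : 𝒰) :
    T A 1 = Coalgebra.counit (R := R) A • 1 :=
  eq_counit_of_idempotent (T.flip 1) (hT.one 1)
    (fun a => (congrArg (T a) (mul_one 1).symm).trans (hT.mul a 1 1)) A

/-- Read backwards, the axiom `ι_mul` says (xA + x ▷ A) ▷ y = x ▷ (A ▷ y): a recursion along
products in `𝒱`, although not along products in `𝒰`. -/
theorem IsExtension.apply_toStar_ι {T : 𝒰 →ₗ[R] 𝒰 →ₗ[R] 𝒰} (hT : IsExtension T) (a : 𝒱)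
    (y : L) : T (toStar R L a) (ι R y) = triAct R L a (ι R y) := by
  induction a using ιBar_mul_induction with
  | one => rw [toStar_one, hT.one, triAct_one]
  | smul r a h => simp only [map_smul, LinearMap.smul_apply, h]
  | add a b ha hb => simp only [map_add, LinearMap.add_apply, ha, hb]
  | ι_mul x a h =>
    rw [toStar_ιBar_mul, map_add, LinearMap.add_apply, hT.ι_mul, hT.apply_ι, h, triAct_ιBar_mul,
      sub_add_cancel]

theorem IsExtension.eq_triExt {T : 𝒰 →ₗ[R] 𝒰 →ₗ[R] 𝒰} (hT : IsExtension T) :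
    T = triExt R L := by
  have hι : ∀ y, T.flip (ι R y) = (triExt R L).flip (ι R y) := fun y => LinearMap.ext fun A => by
    obtain ⟨a, rfl⟩ := exists_toStar A
    rw [LinearMap.flip_apply, LinearMap.flip_apply, hT.apply_toStar_ι, triExt_toStar]
  -- The rule for BC splits the second argument, so the induction is on the length of a word there,
  -- simultaneously for all A.
  suffices h : T.flip = (triExt R L).flip by
    rw [← LinearMap.flip_flip T, h, LinearMap.flip_flip]
  refine linearMap_ext_prod fun l => ?_
  induction l with
  | nil =>
    refine LinearMap.ext fun A => ?_
    simp only [List.map_nil, List.prod_nil, LinearMap.flip_apply, hT.apply_one,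
      isExtension_triExt.apply_one]
  | cons y l ih =>
    refine LinearMap.ext fun A => ?_
    rw [List.map_cons, List.prod_cons, LinearMap.flip_apply, LinearMap.flip_apply, hT.mul,
      isExtension_triExt.mul, sweedlerTri, sweedlerTri, hι, ih]

/-- `starAct_eq` takes the coproduct in `𝒱`, and `star` takes it in `𝒰`; they agree because `toStar`
is a coalgebra map. -/
theorem star_toStar (a b : 𝒱) :
    star (triExt R L) (toStar R L a) (toStar R L b) = toStar R L (a * b) := by
  rw [toStar_mul, starAct_eq]
  change LinearMap.mul' R 𝒰 (((triExt R L).flip (toStar R L b)).lTensor 𝒰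
    (Coalgebra.comul (R := R) (toStar R L a))) = _
  rw [comul_toStar, LinearMap.lTensor, ← LinearMap.comp_apply (TensorProduct.map _ _)
    (TensorProduct.map _ _), ← TensorProduct.map_comp]
  congr 3
  exact LinearMap.ext fun b => by simp [triExt_toStar]

end PostLieAlgebra

/-- The transport of a Hopf algebra along a linear isomorphism which is compatible with the
products and the coproducts. -/
theorem isHopfAlgebra_of_equiv {R H H' : Type*} [CommRing R] [Ring H] [HopfAlgebra R H]
    [AddCommGroup H'] [Module R H'] [Coalgebra R H'] (mul : H' →ₗ[R] H' →ₗ[R] H') (e : H ≃ₗ[R] H')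
    (hmul : ∀ a b, e (a * b) = mul (e a) (e b))
    (hcomul : ∀ a, Coalgebra.comul (R := R) (e a) =
      TensorProduct.map e.toLinearMap e.toLinearMap (Coalgebra.comul (R := R) a))
    (hcounit : ∀ a, Coalgebra.counit (R := R) (e a) = Coalgebra.counit (R := R) a) :
    IsHopfAlgebra R mul (e 1) Coalgebra.comul Coalgebra.counit
      (e.toLinearMap ∘ₗ HopfAlgebra.antipode R ∘ₗ e.symm.toLinearMap) where
  mul_assoc a b c := by
    obtain ⟨a, rfl⟩ := e.surjective a
    obtain ⟨b, rfl⟩ := e.surjective b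
    obtain ⟨c, rfl⟩ := e.surjective c
    simp only [← hmul, mul_assoc]
  one_mul a := by
    obtain ⟨a, rfl⟩ := e.surjective a
    rw [← hmul, one_mul]
  mul_one a := by
    obtain ⟨a, rfl⟩ := e.surjective a
    rw [← hmul, mul_one]
  -- The coproduct and the counit are those already given on `H'`, so the coalgebra laws need no
  -- transport.
  coassoc := Coalgebra.coassoc_apply
  rTensor_counit := Coalgebra.rTensor_counit_comul
  lTensor_counit := Coalgebra.lTensor_counit_comul
  comul_mul a b := by
    obtain ⟨a, rfl⟩ := e.surjective a
    obtain ⟨b, rfl⟩ := e.surjective b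
    rw [← hmul, hcomul, hcomul, hcomul, Bialgebra.comul_mul]
    generalize Coalgebra.comul (R := R) a = t
    generalize Coalgebra.comul (R := R) b = u
    induction t with
    | zero => simp
    | add t t' ht ht' => simp only [add_mul, map_add, LinearMap.add_apply, ht, ht']
    | tmul p q =>
      induction u with
      | zero => simp
      | add u u' hu hu' => simp only [mul_add, map_add, hu, hu']
      | tmul r s => simp [hmul]
  comul_one := by
    rw [hcomul, Bialgebra.comul_one, Algebra.TensorProduct.one_def]; rfl
  counit_mul a b := by
    obtain ⟨a, rfl⟩ := e.surjective a
    obtain ⟨b, rfl⟩ := e.surjective b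
    rw [← hmul, hcounit, hcounit, hcounit, Bialgebra.counit_mul]
  counit_one := by rw [hcounit, Bialgebra.counit_one]
  antipode_left a := by
    obtain ⟨a, rfl⟩ := e.surjective a
    have h := congrArg e (HopfAlgebra.mul_antipode_rTensor_comul_apply (R := R) a)
    rw [Algebra.algebraMap_eq_smul_one, map_smul] at h
    rw [hcomul, hcounit, ← h]
    generalize Coalgebra.comul (R := R) a = t
    induction t with
    | zero => simp
    | add t t' ht ht' => simp only [map_add, ht, ht']
    | tmul p q => simp [hmul]
  antipode_right a := by
    obtain ⟨a, rfl⟩ := e.surjective a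
    have h := congrArg e (HopfAlgebra.mul_antipode_lTensor_comul_apply (R := R) a)
    rw [Algebra.algebraMap_eq_smul_one, map_smul] at h
    rw [hcomul, hcounit, ← h]
    generalize Coalgebra.comul (R := R) a = t
    induction t with
    | zero => simp
    | add t t' ht ht' => simp only [map_add, ht, ht']
    | tmul p q => simp [hmul]

/-! ### The basis of ordered monomials -/

/-- As the factors commute, the new `a j` can be moved left to the power with the same index. -/
theorem List.prod_ofFn_pow_mul {M : Type*} [Monoid M] {n : ℕ} (a : Fin n → M)
    (ha : ∀ i j, Commute (a i) (a j)) (m : Fin n → ℕ) (j : Fin n) :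
    (List.ofFn fun i => a i ^ m i).prod * a j =
      (List.ofFn fun i => a i ^ (m + Pi.single j 1 : Fin n → ℕ) i).prod := by
  induction n with
  | zero => exact j.elim0
  | succ n ih =>
    rw [List.ofFn_succ, List.ofFn_succ, List.prod_cons, List.prod_cons]
    cases j using Fin.cases with
    | zero =>
      have hc : Commute (List.ofFn fun i : Fin n => a i.succ ^ m i.succ).prod (a 0) := by
        refine Commute.list_prod_left _ _ fun x hx => ?_
        obtain ⟨i, rfl⟩ := List.mem_ofFn.1 hx
        exact (ha _ _).pow_left _
      rw [mul_assoc, hc.eq, ← mul_assoc]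
      simp [pow_succ]
    | succ k =>
      rw [mul_assoc, ih (fun i => a i.succ) (fun i j => ha _ _) (fun i => m i.succ) k]
      simp [Pi.single_apply]

namespace TreeLie

open UniversalEnvelopingAlgebra (ι ι_lie commute_ι liftLinear liftLinear_ι)

variable {d : ℕ}

/-! ### The first bracket as a semidirect product of abelian Lie algebras -/

theorem lie_def (u v : TreeLie d) : ⁅u, v⁆ = bracket₀ u v := rfl

theorem planted_eq (p : Planted d) : planted p = I p.1 (Finsupp.single p.2 1) := by
  rw [I_single, planted]

theorem lie_planted (p q : Planted d) : ⁅planted p, planted q⁆ = 0 := by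
  rw [lie_def, planted_eq, planted_eq, bracket₀_I_I]

theorem lie_X (i j : Fin (d + 1)) : ⁅(X i : TreeLie d), X j⁆ = 0 := bracket₀_X_X i j

/-- The projection to the span of the `X_i`. -/
noncomputable def projX : TreeLie d →ₗ[ℝ] TreeLie d :=
  Finsupp.linearCombination ℝ (Sum.elim 0 X)

theorem projX_X (i : Fin (d + 1)) : projX (X i : TreeLie d) = X i := by
  simp [projX, X]

theorem projX_I (a : MultiIdx d) (x : TreeSpan d) : projX (I a x) = 0 := by
  induction x using Finsupp.induction_linear with
  | zero => simp
  | add x x' hx hx' => simp only [map_add, hx, hx', add_zero]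
  | single σ c => simp [I_single, projX]

theorem projX_lower (a : MultiIdx d) (x : TreeSpan d) (i : Fin (d + 1)) :
    projX (lower i a x) = 0 := by
  rw [lower]; split_ifs <;> simp [projX_I]

theorem projX_lie (u v : TreeLie d) : projX ⁅u, v⁆ = 0 := by
  rw [lie_def]
  induction u using TreeLie.induction with
  | h0 => simp
  | hadd x y hx hy => simp only [map_add, LinearMap.add_apply, hx, hy, add_zero]
  | hI a x =>
    induction v using TreeLie.induction with
    | h0 => simp
    | hadd x y hx hy => simp only [map_add, hx, hy, add_zero]
    | hI b y => rw [bracket₀_I_I, map_zero]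
    | hX c i => rw [map_smul, bracket₀_I_X, map_smul, projX_lower, smul_zero]
  | hX c i =>
    induction v using TreeLie.induction with
    | h0 => simp
    | hadd x y hx hy => simp only [map_add, hx, hy, add_zero]
    | hI b y => simp only [map_smul, LinearMap.smul_apply, bracket₀_X_I, map_neg, projX_lower,
        neg_zero, smul_zero]
    | hX c j => simp only [map_smul, LinearMap.smul_apply, bracket₀_X_X, map_zero, smul_zero]

theorem projX_lie_projX (u v : TreeLie d) : ⁅projX u, projX v⁆ = 0 := by
  rw [lie_def]
  induction u using TreeLie.induction with
  | h0 => simp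
  | hadd x y hx hy => simp only [map_add, LinearMap.add_apply, hx, hy, add_zero]
  | hI a x => rw [projX_I, map_zero, LinearMap.zero_apply]
  | hX c i =>
    induction v using TreeLie.induction with
    | h0 => simp
    | hadd x y hx hy => simp only [map_add, hx, hy, add_zero]
    | hI b y => rw [projX_I, map_zero]
    | hX c j => simp only [map_smul, LinearMap.smul_apply, projX_X, bracket₀_X_X, smul_zero]

/-- Only mixed brackets of planted trees with the X_i survive. This form separates the two
contributions to the commutator in `rightOp_lie`. -/
theorem lie_eq_sub_projX (u v : TreeLie d) : ⁅u, v⁆ = ⁅u, projX v⁆ - ⁅v, projX u⁆ := by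
  simp only [lie_def]
  induction u using TreeLie.induction with
  | h0 => simp
  | hadd x y hx hy => simp only [map_add, LinearMap.add_apply, hx, hy]; abel
  | hI a x =>
    induction v using TreeLie.induction with
    | h0 => simp
    | hadd x y hx hy => simp only [map_add, LinearMap.add_apply, hx, hy]; abel
    | hI b y => simp only [bracket₀_I_I, projX_I, map_zero, sub_zero]
    | hX c i => simp only [map_smul, projX_I, projX_X, map_zero, sub_zero]
  | hX c i =>
    induction v using TreeLie.induction with
    | h0 => simp
    | hadd x y hx hy => simp only [map_add, LinearMap.add_apply, hx, hy]; abel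
    | hI b y => simp only [map_smul, LinearMap.smul_apply, projX_I, projX_X, map_zero, zero_sub,
        bracket₀_skew, ← smul_neg]
    | hX c j => simp only [map_smul, LinearMap.smul_apply, projX_X, bracket₀_X_X, smul_zero,
        sub_zero]

/-- The polynomials in the planted trees and the `X_i`. -/
abbrev Poly (d : ℕ) : Type := MvPolynomial (Planted d ⊕ Fin (d + 1)) ℝ

/-- The inclusion of the linear polynomials. -/
noncomputable def toPoly : TreeLie d →ₗ[ℝ] Poly d :=
  Finsupp.linearCombination ℝ MvPolynomial.X

theorem toPoly_single (s : Planted d ⊕ Fin (d + 1)) :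
    toPoly (Finsupp.single s 1) = MvPolynomial.X s := by
  simp [toPoly]

/-- The derivation of the polynomials which extends `w ↦ [w, π v]`, where `π` is the projection
to the span of the `X_i`. -/
noncomputable def polyDer : TreeLie d →ₗ[ℝ] Derivation ℝ (Poly d) (Poly d) where
  toFun v := MvPolynomial.mkDerivation ℝ fun s => toPoly (bracket₀ (Finsupp.single s 1) (projX v))
  map_add' u v := MvPolynomial.derivation_ext fun s => by
    simp only [Derivation.add_apply, MvPolynomial.mkDerivation_X, map_add]
  map_smul' c v := MvPolynomial.derivation_ext fun s => by
    simp only [Derivation.smul_apply, MvPolynomial.mkDerivation_X, map_smul, RingHom.id_apply]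

theorem polyDer_toPoly (v w : TreeLie d) : polyDer v (toPoly w) = toPoly ⁅w, projX v⁆ := by
  rw [lie_def]
  induction w using Finsupp.induction_linear with
  | zero => simp
  | add x y hx hy => simp only [map_add, LinearMap.add_apply, hx, hy]
  | single s c =>
    have hs : (Finsupp.single s c : TreeLie d) = c • Finsupp.single s 1 := by simp
    rw [hs, map_smul, Derivation.map_smul, toPoly_single, map_smul, LinearMap.smul_apply, map_smul]
    congr 1
    exact MvPolynomial.mkDerivation_X _ _ _

theorem polyDer_of_projX_eq_zero {v : TreeLie d} (h : projX v = 0) : polyDer v = 0 := by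
  refine MvPolynomial.derivation_ext fun s => ?_
  rw [← toPoly_single, polyDer_toPoly, h, lie_zero, map_zero, Derivation.zero_apply]

/-- The commutator of two derivations is determined by its values on the variables, where it
vanishes by the Jacobi identity, since the projections of u and v commute. -/
theorem polyDer_comm (u v : TreeLie d) (p : Poly d) :
    polyDer u (polyDer v p) = polyDer v (polyDer u p) := by
  have h : ⁅polyDer u, polyDer v⁆ = 0 := by
    refine MvPolynomial.derivation_ext fun s => ?_
    rw [Derivation.commutator_apply, ← toPoly_single]
    simp only [polyDer_toPoly]
    have hJ := leibniz_lie (Finsupp.single s 1 : TreeLie d) (projX v) (projX u)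
    rw [projX_lie_projX, lie_zero, ← lie_skew (projX v) ⁅_, _⁆, ← sub_eq_add_neg] at hJ
    rw [← map_sub, ← hJ, map_zero, Derivation.zero_apply]
  have h' := Derivation.congr_fun h p
  rwa [Derivation.commutator_apply, Derivation.zero_apply, sub_eq_zero] at h'

/-- The operator of right multiplication by `v` on the polynomials. -/
noncomputable def rightOp : TreeLie d →ₗ[ℝ] Module.End ℝ (Poly d) where
  toFun v := LinearMap.mul ℝ (Poly d) (toPoly v) + (polyDer v).toLinearMap
  map_add' u v := LinearMap.ext fun p => by simp; ring
  map_smul' c v := LinearMap.ext fun p => by simp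

theorem rightOp_apply (v : TreeLie d) (p : Poly d) :
    rightOp v p = toPoly v * p + polyDer v p := rfl

/-- The derivation parts commute, and `polyDer` vanishes on brackets. What is left is the
multiplication by [u, πv] - [v, πu] = [u,v], where π is `projX`. The order is reversed because right
multiplications are modelled. -/
theorem rightOp_lie (u v : TreeLie d) :
    rightOp ⁅u, v⁆ = rightOp v * rightOp u - rightOp u * rightOp v := by
  refine LinearMap.ext fun p => ?_
  simp only [LinearMap.sub_apply, Module.End.mul_apply, rightOp_apply, map_add, Derivation.leibniz,
    polyDer_toPoly, polyDer_of_projX_eq_zero (projX_lie u v), polyDer_comm u v, smul_eq_mul,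
    Derivation.zero_apply]
  rw [lie_eq_sub_projX, map_sub]
  ring

/-- The right action of the enveloping algebra on the polynomials. -/
noncomputable def rightAct (d : ℕ) : U₀ d →ₐ[ℝ] (Module.End ℝ (Poly d))ᵐᵒᵖ :=
  liftLinear ((MulOpposite.opLinearEquiv ℝ).toLinearMap ∘ₗ rightOp) fun u v => by
    simp only [LinearMap.comp_apply, LinearEquiv.coe_coe, MulOpposite.coe_opLinearEquiv,
      rightOp_lie, MulOpposite.op_sub, MulOpposite.op_mul]

theorem rightAct_ι (v : TreeLie d) : rightAct d (ι ℝ v) = MulOpposite.op (rightOp v) :=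
  liftLinear_ι _ _ v

/-- The right action, as a linear map to the endomorphisms. -/
noncomputable def act : U₀ d →ₗ[ℝ] Module.End ℝ (Poly d) :=
  (MulOpposite.opLinearEquiv ℝ).symm.toLinearMap ∘ₗ (rightAct d).toLinearMap

theorem act_one (p : Poly d) : act (1 : U₀ d) p = p := by
  simp [act]

theorem act_mul (u v : U₀ d) (p : Poly d) : act (u * v) p = act v (act u p) := by
  simp [act]

theorem act_ι (v : TreeLie d) (p : Poly d) :
    act (ι ℝ v) p = toPoly v * p + polyDer v p := by
  rw [← rightOp_apply, act, LinearMap.comp_apply, AlgHom.toLinearMap_apply, rightAct_ι]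
  rfl

theorem act_planted (p : Planted d) (q : Poly d) :
    act (ι ℝ (planted p)) q = q * MvPolynomial.X (Sum.inl p) := by
  rw [act_ι, polyDer_of_projX_eq_zero (by rw [planted_eq, projX_I]), planted, toPoly_single,
    Derivation.zero_apply, add_zero, mul_comm]

theorem act_prod_planted (F : List (Planted d)) (q : Poly d) :
    act (F.map fun p => ι ℝ (planted p)).prod q =
      q * (F.map fun p => MvPolynomial.X (Sum.inl p)).prod := by
  induction F generalizing q with
  | nil => simp [act_one]
  | cons p F ih =>
    rw [List.map_cons, List.map_cons, List.prod_cons, List.prod_cons, act_mul, act_planted, ih,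
      mul_assoc]

theorem polyDer_X_inr (v : TreeLie d) (i : Fin (d + 1)) :
    polyDer v (MvPolynomial.X (Sum.inr i)) = 0 := by
  rw [← toPoly_single, polyDer_toPoly, ← X, ← projX_X i, projX_lie_projX, map_zero]

theorem act_X_pow (i : Fin (d + 1)) (k : ℕ) (q : Poly d) (hq : ∀ v, polyDer v q = 0) :
    act (ι ℝ (X i : TreeLie d) ^ k) q = q * MvPolynomial.X (Sum.inr i) ^ k := by
  induction k with
  | zero => simp [act_one]
  | succ k ih =>
    have h0 : polyDer (X i) (q * MvPolynomial.X (Sum.inr i) ^ k) = 0 := by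
      rw [Derivation.leibniz, Derivation.leibniz_pow, polyDer_X_inr, hq]; simp
    rw [pow_succ, act_mul, ih, act_ι, h0, X, toPoly_single]
    ring

theorem act_prod_X_pow (l : List (Fin (d + 1) × ℕ)) (q : Poly d) (hq : ∀ v, polyDer v q = 0) :
    act (l.map fun k => ι ℝ (X k.1 : TreeLie d) ^ k.2).prod q =
      q * (l.map fun k => MvPolynomial.X (Sum.inr k.1) ^ k.2).prod := by
  induction l generalizing q with
  | nil => simp [act_one]
  | cons k l ih =>
    rw [List.map_cons, List.map_cons, List.prod_cons, List.prod_cons, act_mul, act_X_pow _ _ _ hq,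
      ih, mul_assoc]
    -- The polynomial accumulated so far involves, besides `q`, only the variables of the X_i, so it
    -- is again killed by every `polyDer v`.
    intro v
    rw [Derivation.leibniz, Derivation.leibniz_pow, polyDer_X_inr, hq]; simp

/-- The exponents of the monomial `X^m ∏_{p ∈ F} p`. -/
noncomputable def exponent (m : MultiIdx d) (F : List (Planted d)) :
    (Planted d ⊕ Fin (d + 1)) →₀ ℕ :=
  ∑ i, Finsupp.single (Sum.inr i) (m i) + (F.map fun p => Finsupp.single (Sum.inl p) 1).sum

theorem exponent_inr (m : MultiIdx d) (F : List (Planted d)) (i : Fin (d + 1)) :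
    exponent m F (Sum.inr i) = m i := by
  have h : (F.map fun p => Finsupp.single (Sum.inl p : Planted d ⊕ Fin (d + 1)) 1).sum
      (Sum.inr i) = 0 := by
    induction F with
    | nil => simp
    | cons p F ih => simpa using ih
  rw [exponent, Finsupp.add_apply, h, Finsupp.finsetSum_apply, add_zero]
  classical
  simp [Finsupp.single_apply]

open scoped Classical in
theorem exponent_inl (m : MultiIdx d) (F : List (Planted d)) (p : Planted d) :
    exponent m F (Sum.inl p) = F.count p := by
  rw [exponent, Finsupp.add_apply, Finsupp.finsetSum_apply]
  simp only [ne_eq, reduceCtorEq, not_false_eq_true, Finsupp.single_eq_of_ne,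
    Finset.sum_const_zero, zero_add]
  induction F with
  | nil => simp
  | cons q F ih => simp [ih, Finsupp.single_apply, List.count_cons, add_comm]

theorem exponent_toList_injective :
    Function.Injective fun k : MultiIdx d × Multiset (Planted d) => exponent k.1 k.2.toList := by
  classical
  rintro ⟨m, F⟩ ⟨m', F'⟩ h
  have h1 : m = m' := funext fun i => by
    simpa only [exponent_inr] using DFunLike.congr_fun h (Sum.inr i)
  have h2 : F = F' := by
    rw [← Multiset.coe_toList F, ← Multiset.coe_toList F', Multiset.coe_eq_coe,
      List.perm_iff_count]
    intro p
    simpa only [exponent_inl] using DFunLike.congr_fun h (Sum.inl p)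
  rw [h1, h2]

/-- The factors act from left to right. While the X_i act, the polynomial is one in the X_i only,
which every `polyDer` kills; afterwards the planted trees act by plain multiplication. No correction
term ever appears. -/
theorem act_monomial (m : MultiIdx d) (F : List (Planted d)) :
    act (monomial m F) 1 = MvPolynomial.monomial (exponent m F) 1 := by
  have h1 := act_prod_X_pow (List.ofFn fun i => (i, m i)) 1 fun v => (polyDer v).map_one_eq_zero
  rw [List.map_ofFn, List.map_ofFn, List.prod_ofFn, one_mul] at h1
  have h2 : (F.map fun p => (MvPolynomial.X (Sum.inl p) : Poly d)).prod =
      MvPolynomial.monomial (F.map fun p => Finsupp.single (Sum.inl p) 1).sum 1 := by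
    induction F with
    | nil => simp
    | cons p F ih =>
      rw [List.map_cons, List.prod_cons, ih, List.map_cons, List.sum_cons, MvPolynomial.X,
        MvPolynomial.monomial_mul, one_mul]
  rw [monomial, act_mul, act_prod_planted, h2]
  have h3 : act (List.ofFn fun i => ι ℝ (X i : TreeLie d) ^ m i).prod 1 =
      MvPolynomial.monomial (∑ i, Finsupp.single (Sum.inr i) (m i)) 1 := by
    refine h1.trans ?_
    rw [MvPolynomial.monomial_sum_one]
    exact Finset.prod_congr rfl fun i _ => MvPolynomial.X_pow_eq_monomial
  rw [h3, MvPolynomial.monomial_mul, one_mul, exponent]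

/-- Acting on the polynomial 1 sends the family to pairwise distinct elements of the monomial basis
of `Poly d`. -/
theorem linearIndependent_monomial : LinearIndependent ℝ
    fun k : MultiIdx d × Multiset (Planted d) => monomial k.1 k.2.toList := by
  refine LinearIndependent.of_comp (act.flip (1 : Poly d)) ?_
  have h := (MvPolynomial.basisMonomials (Planted d ⊕ Fin (d + 1)) ℝ).linearIndependent.comp _
    exponent_toList_injective
  have hf : act.flip (1 : Poly d) ∘ (fun k : MultiIdx d × Multiset (Planted d) =>
      monomial k.1 k.2.toList) = MvPolynomial.basisMonomials (Planted d ⊕ Fin (d + 1)) ℝ ∘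
        fun k => exponent k.1 k.2.toList := by
    funext k
    simp [act_monomial]
  rw [hf]
  exact h

/-! ### Independence of the order, and spanning -/

theorem monomial_perm (m : MultiIdx d) {F F' : List (Planted d)} (h : F.Perm F') :
    monomial m F = monomial m F' := by
  rw [monomial, monomial]
  congr 1
  refine (h.map _).prod_eq' ?_
  rw [List.pairwise_map]
  exact List.pairwise_of_forall fun p q => commute_ι (lie_planted p q)

theorem monomial_mul_planted (m : MultiIdx d) (F : List (Planted d)) (p : Planted d) :
    monomial m F * ι ℝ (planted p) = monomial m (F ++ [p]) := by
  simp [monomial, mul_assoc, -UniversalEnvelopingAlgebra.ι_apply]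

/-- The span of the ordered monomials. -/
noncomputable def monomialSpan (d : ℕ) : Submodule ℝ (U₀ d) :=
  Submodule.span ℝ (Set.range fun k : MultiIdx d × List (Planted d) => monomial k.1 k.2)

theorem monomial_mem (m : MultiIdx d) (F : List (Planted d)) : monomial m F ∈ monomialSpan d :=
  Submodule.subset_span ⟨(m, F), rfl⟩

theorem mul_mem_of_monomial {v : U₀ d} (h : ∀ m F, monomial m F * v ∈ monomialSpan d) {w : U₀ d}
    (hw : w ∈ monomialSpan d) : w * v ∈ monomialSpan d := by
  induction hw using Submodule.span_induction with
  | mem _ hk => obtain ⟨k, rfl⟩ := hk; exact h _ _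
  | zero => rw [zero_mul]; exact Submodule.zero_mem _
  | add a b _ _ ha hb => rw [add_mul]; exact Submodule.add_mem _ ha hb
  | smul r a _ ha => rw [smul_mul_assoc]; exact Submodule.smul_mem _ r ha

theorem mul_I_mem {w : U₀ d} (hw : w ∈ monomialSpan d) (a : MultiIdx d) (x : TreeSpan d) :
    w * ι ℝ (I a x) ∈ monomialSpan d := by
  induction x using Finsupp.induction_linear with
  | zero => rw [map_zero, map_zero, mul_zero]; exact Submodule.zero_mem _
  | add x y hx hy => rw [map_add, map_add, mul_add]; exact Submodule.add_mem _ hx hy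
  | single τ c =>
    have hs : (Finsupp.single τ c : TreeSpan d) = c • Finsupp.single τ 1 := by simp
    rw [hs, map_smul, map_smul, mul_smul_comm, ← planted_eq (a, τ)]
    refine Submodule.smul_mem _ c (mul_mem_of_monomial (fun m F => ?_) hw)
    rw [monomial_mul_planted]
    exact monomial_mem _ _

/-- Moving X_i to the left past the last planted tree I_a(τ) costs the bracket I_{a - e_i}(τ), or 0
if a_i = 0. This is a planted tree again, which `mul_I_mem` handles; hence the induction from the
right end of the list. -/
theorem mul_X_mem {w : U₀ d} (hw : w ∈ monomialSpan d) (i : Fin (d + 1)) :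
    w * ι ℝ (X i : TreeLie d) ∈ monomialSpan d := by
  refine mul_mem_of_monomial (fun m F => ?_) hw
  induction F using List.reverseRecOn with
  | nil =>
    have h := List.prod_ofFn_pow_mul (fun i => ι ℝ (X i : TreeLie d))
      (fun i j => commute_ι (lie_X i j)) m i
    rw [show monomial m [] * ι ℝ (X i : TreeLie d) = monomial (m + Pi.single i 1) [] by
      simpa only [monomial, List.map_nil, List.prod_nil, mul_one] using h]
    exact monomial_mem _ _
  | append_singleton F p ih =>
    have h : ι ℝ (planted p) * ι ℝ (X i : TreeLie d) =
        ι ℝ (X i : TreeLie d) * ι ℝ (planted p) + ι ℝ ⁅planted p, (X i : TreeLie d)⁆ := by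
      rw [ι_lie]; abel
    rw [← monomial_mul_planted, mul_assoc, h, mul_add, ← mul_assoc, planted_eq, lie_def,
      bracket₀_I_X, lower]
    refine Submodule.add_mem _ (mul_I_mem ih _ _) ?_
    split_ifs
    · simp
    · exact mul_I_mem (monomial_mem _ _) _ _

theorem monomialSpan_eq_top : monomialSpan d = ⊤ := by
  refine Submodule.eq_top_iff'.2 fun u => ?_
  -- The span contains 1, so stability under right multiplication is enough; this property of `u`
  -- passes to sums and products.
  suffices h : ∀ w ∈ monomialSpan d, w * u ∈ monomialSpan d by
    have h1 : (1 : U₀ d) ∈ monomialSpan d := by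
      simpa [monomial] using monomial_mem (0 : MultiIdx d) []
    simpa using h 1 h1
  induction u using UniversalEnvelopingAlgebra.induction with
  | hR r =>
    intro w hw
    rw [← Algebra.commutes, ← Algebra.smul_def]
    exact Submodule.smul_mem _ r hw
  | hι v =>
    intro w hw
    induction v using TreeLie.induction with
    | h0 => simp
    | hadd x y hx hy => rw [map_add, mul_add]; exact Submodule.add_mem _ hx hy
    | hI a x => exact mul_I_mem hw a x
    | hX c i => rw [map_smul, mul_smul_comm]; exact Submodule.smul_mem _ c (mul_X_mem hw i)
  | hadd a b ha hb =>
    intro w hw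
    rw [mul_add]
    exact Submodule.add_mem _ (ha w hw) (hb w hw)
  | hmul a b ha hb =>
    intro w hw
    rw [← mul_assoc]
    exact hb _ (ha w hw)

theorem monomial_toList (m : MultiIdx d) (F : List (Planted d)) :
    monomial m (F : Multiset (Planted d)).toList = monomial m F :=
  monomial_perm m (Multiset.coe_eq_coe.1 (Multiset.coe_toList _))

/-- The basis of the ordered monomials `X_0^{m_0} ⋯ X_d^{m_d} I_{a_1}(σ_1) ⋯ I_{a_n}(σ_n)`. -/
noncomputable def monomialBasis (d : ℕ) :
    Module.Basis (MultiIdx d × Multiset (Planted d)) ℝ (U₀ d) :=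
  Module.Basis.mk linearIndependent_monomial (by
    rw [← monomialSpan_eq_top, monomialSpan]
    refine Submodule.span_mono ?_
    rintro _ ⟨⟨m, F⟩, rfl⟩
    exact ⟨(m, F), monomial_toList m F⟩)

theorem monomialBasis_apply (m : MultiIdx d) (F : List (Planted d)) :
    monomialBasis d (m, F) = monomial m F := by
  rw [monomialBasis, Module.Basis.mk_apply, monomial_toList]

end TreeLie

/-! ### The theorem for decorated trees -/

theorem mainTheorem1 (d : ℕ) :
    ∃ T : TreeLie.U₀ d →ₗ[ℝ] TreeLie.U₀ d →ₗ[ℝ] TreeLie.U₀ d,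
      (PostLieAlgebra.IsExtension T ∧ ∀ T', PostLieAlgebra.IsExtension T' → T' = T) ∧
      ∃ S : TreeLie.U₀ d →ₗ[ℝ] TreeLie.U₀ d,
        IsHopfAlgebra ℝ (PostLieAlgebra.star T) 1 Coalgebra.comul Coalgebra.counit S ∧
        ∃ e : TreeLie.UBar d ≃ₗ[ℝ] TreeLie.U₀ d,
          (∀ v : TreeLie d, e (UniversalEnvelopingAlgebra.ι ℝ (PostLieBar.of ℝ (TreeLie d) v)) =
            UniversalEnvelopingAlgebra.ι ℝ v) ∧
          e 1 = 1 ∧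
          (∀ a b, e (a * b) = PostLieAlgebra.star T (e a) (e b)) ∧
          (∀ a, Coalgebra.comul (R := ℝ) (e a) =
            TensorProduct.map e.toLinearMap e.toLinearMap (Coalgebra.comul (R := ℝ) a)) ∧
          (∀ a, Coalgebra.counit (R := ℝ) (e a) = Coalgebra.counit (R := ℝ) a) ∧
          (∀ a, e (HopfAlgebra.antipode ℝ a) = S (e a)) ∧
          ∃ B₀ : Module.Basis (MultiIdx d × Multiset (Planted d)) ℝ (TreeLie.U₀ d),
            (∀ (m : MultiIdx d) (F : List (Planted d)),
              B₀ (m, (F : Multiset (Planted d))) = TreeLie.monomial m F) ∧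
            ∃ B : Module.Basis (MultiIdx d × Multiset (Planted d)) ℝ (TreeLie.UBar d),
              ∀ k, e (B k) = B₀ k := by
  have hcounit := PostLieAlgebra.counit_toStar (R := ℝ) (L := TreeLie d)
  have hcomul := PostLieAlgebra.comul_toStar (R := ℝ) (L := TreeLie d)
  have hmul := fun a b => (PostLieAlgebra.star_toStar (R := ℝ) (L := TreeLie d) a b).symm
  have hone := PostLieAlgebra.toStar_one (R := ℝ) (L := TreeLie d)
  have hopf := isHopfAlgebra_of_equiv (PostLieAlgebra.star (PostLieAlgebra.triExt ℝ (TreeLie d)))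
    (PostLieAlgebra.starEquiv ℝ (TreeLie d)) hmul hcomul hcounit
  rw [PostLieAlgebra.starEquiv_apply, hone] at hopf
  refine ⟨PostLieAlgebra.triExt ℝ (TreeLie d), ⟨PostLieAlgebra.isExtension_triExt,
    fun T' hT' => hT'.eq_triExt⟩, _, hopf, PostLieAlgebra.starEquiv ℝ (TreeLie d),
    PostLieAlgebra.toStar_ιBar, hone, hmul, hcomul, hcounit, fun a => ?_,
    TreeLie.monomialBasis d, TreeLie.monomialBasis_apply,
    (TreeLie.monomialBasis d).map (PostLieAlgebra.starEquiv ℝ (TreeLie d)).symm, fun k => ?_⟩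
  -- The antipode S is the conjugate of the antipode of `UBar d` by e, so e intertwines the two.
  · rw [LinearMap.comp_apply, LinearMap.comp_apply, LinearEquiv.coe_coe, LinearEquiv.coe_coe,
      LinearEquiv.symm_apply_apply]
  · rw [Module.Basis.map_apply, LinearEquiv.apply_symm_apply]
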